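/- Let $I\subseteq\mathbb{R}$ be an open interval, $F$ a smooth manifold without boundary, $\beta\in C^\infty(I)$ a positive function and $(g_t)_{t\in I}$ a smooth one-parameter family of Riemannian metrics on $F$. Endow $I\times F$ with the Riemannian metric $\overline g=\beta\,dt^2+g_t$, that is, $\overline g=\beta\,\pi_I^*(dt^2)+\pi_F^*(g_t)$ with $\pi_I,\pi_F$ the canonical projections. Assume that $(I\times F,\overline g)$ is monotone: either it is non-shrinking throughout $\partial_t$, i.e. $\partial_t\beta\ge 0$ on $I$ and $(\partial_t g_t)(X,X)\ge 0$ for all $t\in I$ and all tangent vectors $X$ of $F$, or it is non-expanding throughout $\partial_t$, i.e. $\partial_t\beta\le 0$ on $I$ and $(\partial_t g_t)(X,X)\le 0$ for all such $t$ and $X$. Let $S$ be a compact connected smooth manifold without boundary and let $x:S\to I\times F$ be a minimal submanifold, i.e. a smooth immersion whose mean curvature vector vanishes identically. (Here, for $n=\dim S$, the mean curvature vector $H$ is given by $nH=\sum_{i=1}^n \mathrm{II}(E_i,E_i)$, where $(E_i)$ is an orthonormal basis of $T_pS$ for the induced metric and $\mathrm{II}(X,Y)=(\overline\nabla_XY)^\perp$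 is the second fundamental form, $\overline\nabla$ being the Levi-Civita connection of $\overline g$.) Then $S$ is contained in a level hypersurface $t=\mathrm{const}$: there is $t_0\in I$ with $\pi_I(x(p))=t_0$ for all $p\in S$. If moreover the codimension $\dim F+1-\dim S$ of $S$ in $I\times F$ is greater than one, then $\pi_F\circ x:S\to F$ is a minimal submanifold of the Riemannian manifold $(F,g_{t_0})$. -/

import Mathlib

open scoped Manifold ContDiff
open Bundle Module

noncomputable section

namespace MinimalSubmanifolds

/-! ### Local Riemannian geometry in vector spaces -/

section Local

variable {V W : Type*} [NormedAddCommGroup V] [NormedSpace ℝ V]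
  [NormedAddCommGroup W] [NormedSpace ℝ W]

/-- `IsChristoffelVector G y a b c` says that `c` is the value `Γ_y(a, b)` of the Christoffel
symbols at `y` of the metric `G` on (an open subset of) `W`, that is, the value at `y` of
`∇_A B` for the constant vector fields `A = a`, `B = b` and the Levi-Civita connection `∇`:
`2 G(Γ(a, b), z) = a(G(b, z)) + b(G(a, z)) - z(G(a, b))` for all `z`
(the Koszul formula for constant, hence commuting, vector fields). -/
def IsChristoffelVector (G : W → W →L[ℝ] W →L[ℝ] ℝ) (y a b c : W) : Prop :=
  ∀ z : W, 2 * G y c z = fderiv ℝ G y a b z + fderiv ℝ G y b a z - fderiv ℝ G y z a b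

/-- The Christoffel symbols `Γ_y(a, b)` of the metric `G`; see `christoffel_spec`. -/
def christoffel (G : W → W →L[ℝ] W →L[ℝ] ℝ) (y a b : W) : W :=
  Classical.epsilon (IsChristoffelVector G y a b)

/-- `IsNormalPart B T v w` says that `w` is the component of `v` that is `B`-orthogonal to the
subspace `T`. -/
def IsNormalPart (B : W →L[ℝ] W →L[ℝ] ℝ) (T : Submodule ℝ W) (v w : W) : Prop :=
  v - w ∈ T ∧ ∀ u ∈ T, B w u = 0

/-- The normal component `v^⊥` of `v` with respect to the subspace `T` and the inner product
`B`; see `normalPart_spec`. -/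
def normalPart (B : W →L[ℝ] W →L[ℝ] ℝ) (T : Submodule ℝ W) (v : W) : W :=
  Classical.epsilon (IsNormalPart B T v)

/-- The second fundamental form `II(u, v) = (∇_u (DX v))^⊥` at `y` of the parametrized
submanifold `X` of (an open subset of) `W` with the metric `G`, on constant vector fields
`u`, `v`: the covariant derivative along `X` is `D²X(u, v) + Γ_{X(y)}(DX u, DX v)`. -/
def localSecondFundamentalForm (G : W → W →L[ℝ] W →L[ℝ] ℝ) (X : V → W) (y u v : V) : W :=
  normalPart (G (X y)) (LinearMap.range (fderiv ℝ X y).toLinearMap)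
    (fderiv ℝ (fderiv ℝ X) y u v + christoffel G (X y) (fderiv ℝ X y u) (fderiv ℝ X y v))

/-- The basis `e` is orthonormal at `y` for the metric induced by `X` from `G`. -/
def IsInducedOrthonormal (G : W → W →L[ℝ] W →L[ℝ] ℝ) (X : V → W) (y : V)
    {n : ℕ} (e : Basis (Fin n) ℝ V) : Prop :=
  ∀ i j, G (X y) (fderiv ℝ X y (e i)) (fderiv ℝ X y (e j)) = if i = j then 1 else 0

/-- The mean curvature vector of `X` vanishes at `y`: `n H = ∑ i, II(e i, e i) = 0` for the
orthonormal bases `e` of the tangent space. -/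
def LocalMeanCurvatureZero (G : W → W →L[ℝ] W →L[ℝ] ℝ) (X : V → W) (y : V) : Prop :=
  ∀ e : Basis (Fin (finrank ℝ V)) ℝ V, IsInducedOrthonormal G X y e →
    ∑ i, localSecondFundamentalForm G X y (e i) (e i) = 0

section Spec

variable [FiniteDimensional ℝ W]

/-- Riesz representation for a positive definite form. -/
theorem exists_representing (B : W →L[ℝ] W →L[ℝ] ℝ) (hB : ∀ v, v ≠ 0 → 0 < B v v)
    (f : W →ₗ[ℝ] ℝ) : ∃ c, ∀ z, B c z = f z := by
  let L : W →ₗ[ℝ] (W →L[ℝ] ℝ) := B.toLinearMap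
  have hinj : Function.Injective (LinearMap.toContinuousLinearMap.symm.toLinearMap ∘ₗ L) := by
    rw [← LinearMap.ker_eq_bot, LinearMap.ker_eq_bot']
    intro v hv
    by_contra h
    have h1 : B v v = 0 := by simpa [L] using congrArg (fun l : W →ₗ[ℝ] ℝ => l v) hv
    exact (hB v h).ne' h1
  have hsurj := (LinearMap.injective_iff_surjective_of_finrank_eq_finrank
    (by simp)).1 hinj
  obtain ⟨c, hc⟩ := hsurj f
  exact ⟨c, fun z => congrArg (fun l : W →ₗ[ℝ] ℝ => l z) hc⟩

/-- The Christoffel symbols of a metric that is positive definite at `y` satisfy their defining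
equation. -/
theorem christoffel_spec (G : W → W →L[ℝ] W →L[ℝ] ℝ) (y a b : W)
    (hG : ∀ v, v ≠ 0 → 0 < G y v v) : IsChristoffelVector G y a b (christoffel G y a b) := by
  apply Classical.epsilon_spec (p := IsChristoffelVector G y a b)
  let f : W →ₗ[ℝ] ℝ := (2⁻¹ : ℝ) • ((fderiv ℝ G y a b).toLinearMap
    + (fderiv ℝ G y b a).toLinearMap - (((fderiv ℝ G y).flip a).flip b).toLinearMap)
  obtain ⟨c, hc⟩ := exists_representing (G y) hG f
  refine ⟨c, fun z => ?_⟩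
  rw [hc z]
  simp [f]

/-- Normal components exist for positive definite forms. -/
theorem normalPart_spec (B : W →L[ℝ] W →L[ℝ] ℝ) (hB : ∀ v, v ≠ 0 → 0 < B v v)
    (T : Submodule ℝ W) (v : W) : IsNormalPart B T v (normalPart B T v) := by
  apply Classical.epsilon_spec (p := IsNormalPart B T v)
  let BT : T →L[ℝ] T →L[ℝ] ℝ := B.bilinearComp T.subtypeL T.subtypeL
  obtain ⟨c, hc⟩ := exists_representing BT
    (fun u hu => hB u (by simpa using hu)) ((B v).toLinearMap ∘ₗ T.subtype)
  refine ⟨v - c, by simp, fun u hu => ?_⟩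
  have := hc ⟨u, hu⟩
  simp [BT] at this
  simp [this]

end Spec

end Local

/-! ### Minimal submanifolds of Riemannian manifolds -/

section Manifold

variable {E H M E' H' M' : Type*}
  [NormedAddCommGroup E] [NormedSpace ℝ E] [TopologicalSpace H]
  [TopologicalSpace M] [ChartedSpace H M]
  [NormedAddCommGroup E'] [NormedSpace ℝ E'] [TopologicalSpace H']
  [TopologicalSpace M'] [ChartedSpace H' M']

/-- The components of the `(0,2)`-tensor field `g` on `M` in the chart `c`, as a function on the
model vector space: the pullback of `g` by the inverse of the chart. -/
def chartMetric (J : ModelWithCorners ℝ E H)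
    (g : (q : M) → TangentSpace J q →L[ℝ] TangentSpace J q →L[ℝ] ℝ)
    (c : OpenPartialHomeomorph M H) (y : E) : E →L[ℝ] E →L[ℝ] ℝ :=
  let A : E →L[ℝ] E := mfderiv 𝓘(ℝ, E) J (c.extend J).symm y
  let B : E →L[ℝ] E →L[ℝ] ℝ := g ((c.extend J).symm y)
  B.bilinearComp A A

/-- `x : S → M` is a minimal submanifold of `M` with the Riemannian metric `g`: a smooth
immersion whose mean curvature vector vanishes at every point. The condition does not depend on
the charts in which the mean curvature vector is computed. The metric need only be defined near
the image of `x`. The manifolds are without boundary. -/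
structure IsMinimalSubmanifold (I : ModelWithCorners ℝ E' H') (J : ModelWithCorners ℝ E H)
    (g : (q : M) → TangentSpace J q →L[ℝ] TangentSpace J q →L[ℝ] ℝ) (x : M' → M) : Prop where
  contMDiff : ContMDiff I J ∞ x
  injective_mfderiv : ∀ p, Function.Injective (mfderiv I J x p)
  meanCurvature_eq_zero :
    ∀ φ ∈ IsManifold.maximalAtlas I ∞ M', ∀ ψ ∈ IsManifold.maximalAtlas J ∞ M,
      ∀ p ∈ φ.source, x p ∈ ψ.source →
        LocalMeanCurvatureZero (chartMetric J g ψ)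
          (ψ.extend J ∘ x ∘ (φ.extend I).symm) (φ.extend I p)

end Manifold

/-! ### The metrics `β dt² + g_t` on `I × F` -/

section Split

variable {k : ℕ} {F : Type*} [TopologicalSpace F] [ChartedSpace (EuclideanSpace ℝ (Fin k)) F]

/-- `g` is a smooth one-parameter family of Riemannian metrics `g t` on `F`, `t ∈ I`
(the values of `g` outside `I` are irrelevant). -/
structure IsRiemannianMetricFamily [IsManifold (𝓡 k) ∞ F] (I : Set ℝ)
    (g : ℝ → (p : F) → TangentSpace (𝓡 k) p →L[ℝ] TangentSpace (𝓡 k) p →L[ℝ] ℝ) : Prop where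
  symm : ∀ t ∈ I, ∀ p u v, g t p u v = g t p v u
  pos : ∀ t ∈ I, ∀ p v, v ≠ 0 → 0 < g t p v v
  contMDiffOn : ContMDiffOn (𝓘(ℝ, ℝ).prod (𝓡 k))
    ((𝓡 k).prod 𝓘(ℝ, EuclideanSpace ℝ (Fin k) →L[ℝ] EuclideanSpace ℝ (Fin k) →L[ℝ] ℝ)) ∞
    (fun q : ℝ × F => TotalSpace.mk'
      (EuclideanSpace ℝ (Fin k) →L[ℝ] EuclideanSpace ℝ (Fin k) →L[ℝ] ℝ)
      (E := fun p : F => TangentSpace (𝓡 k) p →L[ℝ] TangentSpace (𝓡 k) p →L[ℝ] ℝ)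
      q.2 (g q.1 q.2))
    (I ×ˢ Set.univ)

/-- The metric `β dt² + g_t`, that is, `β π_I^*(dt²) + π_F^*(g_t)`. -/
def splitMetric (β : ℝ → ℝ)
    (g : ℝ → (p : F) → TangentSpace (𝓡 k) p →L[ℝ] TangentSpace (𝓡 k) p →L[ℝ] ℝ) (q : ℝ × F) :
    TangentSpace (𝓘(ℝ, ℝ).prod (𝓡 k)) q →L[ℝ] TangentSpace (𝓘(ℝ, ℝ).prod (𝓡 k)) q →L[ℝ] ℝ :=
  let B : EuclideanSpace ℝ (Fin k) →L[ℝ] EuclideanSpace ℝ (Fin k) →L[ℝ] ℝ := g q.1 q.2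
  let dt : ℝ × EuclideanSpace ℝ (Fin k) →L[ℝ] ℝ := ContinuousLinearMap.fst ℝ _ _
  let dπ : ℝ × EuclideanSpace ℝ (Fin k) →L[ℝ] EuclideanSpace ℝ (Fin k) :=
    ContinuousLinearMap.snd ℝ _ _
  (β q.1 • (ContinuousLinearMap.mul ℝ ℝ).bilinearComp dt dt + B.bilinearComp dπ dπ :
    ℝ × EuclideanSpace ℝ (Fin k) →L[ℝ] ℝ × EuclideanSpace ℝ (Fin k) →L[ℝ] ℝ)

theorem splitMetric_apply (β : ℝ → ℝ)
    (g : ℝ → (p : F) → TangentSpace (𝓡 k) p →L[ℝ] TangentSpace (𝓡 k) p →L[ℝ] ℝ) (q : ℝ × F)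
    (a b : ℝ) (v w : TangentSpace (𝓡 k) q.2) :
    splitMetric β g q (a, v) (b, w) = β q.1 * (a * b) + g q.1 q.2 v w := rfl

/-- `β dt² + g_t` is non-shrinking throughout `∂_t`: `∂_t β ≥ 0` and `∂_t g_t ≥ 0`. -/
def IsNonShrinking (I : Set ℝ) (β : ℝ → ℝ)
    (g : ℝ → (p : F) → TangentSpace (𝓡 k) p →L[ℝ] TangentSpace (𝓡 k) p →L[ℝ] ℝ) : Prop :=
  ∀ t ∈ I, 0 ≤ deriv β t ∧
    ∀ (p : F) (v : TangentSpace (𝓡 k) p), 0 ≤ deriv (fun s => g s p v v) t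

/-- `β dt² + g_t` is non-expanding throughout `∂_t`: `∂_t β ≤ 0` and `∂_t g_t ≤ 0`. -/
def IsNonExpanding (I : Set ℝ) (β : ℝ → ℝ)
    (g : ℝ → (p : F) → TangentSpace (𝓡 k) p →L[ℝ] TangentSpace (𝓡 k) p →L[ℝ] ℝ) : Prop :=
  ∀ t ∈ I, deriv β t ≤ 0 ∧
    ∀ (p : F) (v : TangentSpace (𝓡 k) p), deriv (fun s => g s p v v) t ≤ 0

/-- `β dt² + g_t` is monotone. -/
def IsMonotone (I : Set ℝ) (β : ℝ → ℝ)
    (g : ℝ → (p : F) → TangentSpace (𝓡 k) p →L[ℝ] TangentSpace (𝓡 k) p →L[ℝ] ℝ) : Prop :=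
  IsNonShrinking I β g ∨ IsNonExpanding I β g

end Split

end MinimalSubmanifolds

end

/-! Let `u = t ∘ x`. Minimality says that for an induced orthonormal basis `e i` the sum of the
covariant accelerations `D²X(e i, e i) + Γ(DX e i, DX e i)` is tangent to `S`, say equal to `DX ξ`.
For a split metric the Koszul formula tested on `∂_t` gives `2β Γ(a, a)^t = β' (a^t)² - (∂_t g)(a,
a)`. The `t`-component of the sum therefore reads `∑ D²u(e i, e i) = Du(ξ) - β'/(2β) ∑ Du(e i)² +
(1/2β) ∑ (∂_t g)(e i, e i)`, where the last term is evaluated on the `F`-parts of `DX e i`.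

The middle term is quadratic in `Du`, but equals `Du` applied to a multiple of the bounded vector `∑
Du(e i) e i`, so it belongs to the drift. If `σ ∂_t g ≥ 0`, what remains says that `σ u` is a
subsolution of a uniformly elliptic linear operator without zeroth order term
(`isSubsolutionAt_of_localMeanCurvatureZero`). By the strong maximum principle
(`eventually_eq_of_isLocalMax`), `σ u` is constant near each local maximum. On compact connected `S`
the set where the maximum is attained is nonempty, closed and open, hence everything.

Once `u` is constant, the `F`-component of `II` is the second fundamental form in the slice
(`localMeanCurvatureZero_of_slice`), so its trace vanishes there too. -/

noncomputable section

open Filter Topology Metric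

namespace MinimalSubmanifolds

/-! ### The strong maximum principle -/

section MaximumPrinciple

variable {E : Type*} [NormedAddCommGroup E] [InnerProductSpace ℝ E]

/-- The second derivative is nonpositive at a local maximum. -/
theorem secondDeriv_nonpos_of_isLocalMax {f f' : ℝ → ℝ} {f'' : ℝ}
    (hf : ∀ᶠ s in 𝓝 0, HasDerivAt f (f' s) s) (hf' : HasDerivAt f' f'' 0)
    (hmax : IsLocalMax f 0) : f'' ≤ 0 := by
  by_contra! hpos
  have h1 : deriv f =ᶠ[𝓝 0] f' := hf.mono fun s hs => hs.deriv
  have h2 : deriv (deriv f) 0 = f'' := by rw [h1.deriv_eq, hf'.deriv]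
  -- A positive second derivative makes the local maximum a local minimum as well, so `f` is
  -- constant near `0` and its second derivative vanishes.
  have h3 : IsLocalMin f 0 := isLocalMin_of_deriv_deriv_pos (by rwa [h2]) hmax.deriv_eq_zero
    hf.self_of_nhds.continuousAt
  have h4 : f =ᶠ[𝓝 0] fun _ => f 0 := by
    filter_upwards [hmax, h3] with s hs hs' using le_antisymm hs hs'
  have h5 : f' =ᶠ[𝓝 0] fun _ => 0 := by
    filter_upwards [h4.eventuallyEq_nhds, h1] with s hs hs'
    rw [← hs', hs.deriv_eq, deriv_const]
  have h6 : f'' = 0 := by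
    rw [← hf'.deriv, h5.deriv_eq, deriv_const]
  exact hpos.ne' h6

theorem hasDerivAt_gaussian_line (α : ℝ) (w e : E) (s : ℝ) :
    HasDerivAt (fun s : ℝ => Real.exp (-α * ‖w + s • e‖ ^ 2))
      (Real.exp (-α * ‖w + s • e‖ ^ 2) * (-2 * α * (inner ℝ w e + s * ‖e‖ ^ 2))) s := by
  have h : HasDerivAt (fun s : ℝ => w + s • e) e s := by
    simpa using ((hasDerivAt_id s).smul_const e).const_add w
  convert! ((h.norm_sq).const_mul (-α)).exp using 1
  rw [inner_add_left, real_inner_smul_left, real_inner_self_eq_norm_sq]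
  ring

theorem hasDerivAt_deriv_gaussian_line (α : ℝ) (w e : E) :
    HasDerivAt (fun s : ℝ => Real.exp (-α * ‖w + s • e‖ ^ 2)
        * (-2 * α * (inner ℝ w e + s * ‖e‖ ^ 2)))
      (Real.exp (-α * ‖w‖ ^ 2) * (4 * α ^ 2 * inner ℝ w e ^ 2 - 2 * α * ‖e‖ ^ 2)) 0 := by
  have h1 := hasDerivAt_gaussian_line α w e 0
  have h2 : HasDerivAt (fun s : ℝ => -2 * α * (inner ℝ w e + s * ‖e‖ ^ 2))
      (-2 * α * ‖e‖ ^ 2) 0 := by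
    simpa using (((hasDerivAt_id (0 : ℝ)).mul_const (‖e‖ ^ 2)).const_add
      (inner ℝ w e)).const_mul (-2 * α)
  convert! h1.mul h2 using 1
  simp only [zero_smul, add_zero, zero_mul]
  ring

theorem hasDerivAt_line {u : E → ℝ} {y e : E} {s : ℝ} (hu : DifferentiableAt ℝ u (y + s • e)) :
    HasDerivAt (fun s : ℝ => u (y + s • e)) (fderiv ℝ u (y + s • e) e) s := by
  have h : HasDerivAt (fun s : ℝ => y + s • e) e s := by
    simpa using ((hasDerivAt_id s).smul_const e).const_add y
  exact hu.hasFDerivAt.comp_hasDerivAt s h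

theorem hasDerivAt_fderiv_line {u : E → ℝ} {y e : E} (hu : ContDiffAt ℝ 2 u y) :
    HasDerivAt (fun s : ℝ => fderiv ℝ u (y + s • e) e) (fderiv ℝ (fderiv ℝ u) y e e) 0 := by
  have h : HasDerivAt (fun s : ℝ => y + s • e) e 0 := by
    simpa using ((hasDerivAt_id (0 : ℝ)).smul_const e).const_add y
  have h1 : DifferentiableAt ℝ (fderiv ℝ u) (y + (0 : ℝ) • e) := by
    simpa using (hu.fderiv_right (m := 1) le_rfl).differentiableAt one_ne_zero
  have h2 : HasFDerivAt (fderiv ℝ u) (fderiv ℝ (fderiv ℝ u) y) (y + (0 : ℝ) • e) := by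
    simpa only [zero_smul, add_zero] using h1.hasFDerivAt
  exact (ContinuousLinearMap.apply ℝ ℝ e).hasFDerivAt.comp_hasDerivAt (0 : ℝ)
    (h2.comp_hasDerivAt (0 : ℝ) h)

theorem eventually_line {y e : E} {p : E → Prop} (h : ∀ᶠ z in 𝓝 y, p z) :
    ∀ᶠ s in 𝓝 (0 : ℝ), p (y + s • e) := by
  have hc : Tendsto (fun s : ℝ => y + s • e) (𝓝 0) (𝓝 y) := by
    have : Continuous fun s : ℝ => y + s • e := by fun_prop
    simpa using this.tendsto 0
  exact hc.eventually h

/-- The first and second order conditions at a local maximum of `u + ε exp (-α |· - z|²)`. -/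
theorem derivatives_of_isLocalMax_add_gaussian {u : E → ℝ} {y z : E} {α ε : ℝ}
    (hu : ContDiffAt ℝ 2 u y)
    (hmax : IsLocalMax (fun x => u x + ε * Real.exp (-α * ‖x - z‖ ^ 2)) y) (e : E) :
    fderiv ℝ u y e = ε * Real.exp (-α * ‖y - z‖ ^ 2) * (2 * α * inner ℝ (y - z) e) ∧
    fderiv ℝ (fderiv ℝ u) y e e ≤ -(ε * Real.exp (-α * ‖y - z‖ ^ 2)
      * (4 * α ^ 2 * inner ℝ (y - z) e ^ 2 - 2 * α * ‖e‖ ^ 2)) := by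
  have hdiff : ∀ᶠ x in 𝓝 y, DifferentiableAt ℝ u x :=
    (hu.eventually (by simp)).mono fun x hx => hx.differentiableAt two_ne_zero
  have key : ∀ᶠ s in 𝓝 (0 : ℝ), HasDerivAt
      (fun s : ℝ => u (y + s • e) + ε * Real.exp (-α * ‖y - z + s • e‖ ^ 2))
      (fderiv ℝ u (y + s • e) e + ε * (Real.exp (-α * ‖y - z + s • e‖ ^ 2)
        * (-2 * α * (inner ℝ (y - z) e + s * ‖e‖ ^ 2)))) s := by
    filter_upwards [eventually_line (e := e) hdiff] with s hs
    exact (hasDerivAt_line hs).add ((hasDerivAt_gaussian_line α (y - z) e s).const_mul ε)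
  have hm : IsLocalMax
      (fun s : ℝ => u (y + s • e) + ε * Real.exp (-α * ‖y - z + s • e‖ ^ 2)) 0 := by
    filter_upwards [eventually_line (e := e) hmax] with s hs
    simpa [add_sub_right_comm] using hs
  constructor
  · have := hm.hasDerivAt_eq_zero key.self_of_nhds
    simp only [zero_smul, add_zero, zero_mul] at this
    linarith
  · have := secondDeriv_nonpos_of_isLocalMax key
      ((hasDerivAt_fderiv_line hu).add ((hasDerivAt_deriv_gaussian_line α (y - z) e).const_mul ε))
      hm
    linarith

/-- `IsSubsolutionAt C u y` says that at `y` the function `u` satisfies `∑ D²u(eᵢ, eᵢ) ≥ Du(ξ)` for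
vectors `eᵢ`, `ξ` such that the operator is elliptic and bounded with constant `C`. -/
def IsSubsolutionAt (ι : Type*) [Fintype ι] (C : ℝ) (u : E → ℝ) (y : E) : Prop :=
  ∃ (e : ι → E) (ξ : E), (∀ i, ‖e i‖ ≤ C) ∧ ‖ξ‖ ≤ C ∧
    (∀ v, ‖v‖ ^ 2 ≤ C * ∑ i, inner ℝ v (e i) ^ 2) ∧
    fderiv ℝ u y ξ ≤ ∑ i, fderiv ℝ (fderiv ℝ u) y (e i) (e i)

/-- At such a maximum the derivatives of `u` are minus those of the Gaussian. Its second derivatives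
contribute `4α²⟨y - z, e i⟩²`, which ellipticity bounds below on the annulus, while every other term
is linear in `α`; for large `α` the subsolution inequality fails. -/
theorem not_isLocalMax_add_gaussian {ι : Type*} [Fintype ι] {C : ℝ} {u : E → ℝ} {y z : E}
    {α ε r : ℝ} (hC : 0 < C) (hu : ContDiffAt ℝ 2 u y) (hsub : IsSubsolutionAt ι C u y)
    (hε : 0 < ε) (hα : 0 < α) (hr : 0 < r) (hry : r ≤ ‖y - z‖) (hyr : ‖y - z‖ ≤ 3 * r)
    (hbig : C * (C ^ 2 * Fintype.card ι + 3 * r * C) < 2 * α * r ^ 2) :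
    ¬ IsLocalMax (fun x => u x + ε * Real.exp (-α * ‖x - z‖ ^ 2)) y := by
  intro hmax
  obtain ⟨e, ξ, he, hξ, hell, hle⟩ := hsub
  have H := derivatives_of_isLocalMax_add_gaussian hu hmax
  set K := ε * Real.exp (-α * ‖y - z‖ ^ 2) with hK
  have hKpos : 0 < K := by positivity
  have h1 : fderiv ℝ u y ξ ≤ K * ∑ i, -(4 * α ^ 2 * inner ℝ (y - z) (e i) ^ 2
      - 2 * α * ‖e i‖ ^ 2) := by
    rw [Finset.mul_sum]
    refine hle.trans (Finset.sum_le_sum fun i _ => ?_)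
    have := (H (e i)).2
    linarith
  rw [(H ξ).1] at h1
  have h2 := le_of_mul_le_mul_left h1 hKpos
  have h3 : ∑ i, ‖e i‖ ^ 2 ≤ Fintype.card ι * C ^ 2 := by
    have : ∑ i, ‖e i‖ ^ 2 ≤ ∑ _i : ι, C ^ 2 :=
      Finset.sum_le_sum fun i _ => by gcongr; exact he i
    simpa using this
  have h4 : ∑ i, -(4 * α ^ 2 * inner ℝ (y - z) (e i) ^ 2 - 2 * α * ‖e i‖ ^ 2)
      = -(4 * α ^ 2) * ∑ i, inner ℝ (y - z) (e i) ^ 2 + 2 * α * ∑ i, ‖e i‖ ^ 2 := by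
    rw [Finset.mul_sum, Finset.mul_sum, ← Finset.sum_add_distrib]
    exact Finset.sum_congr rfl fun i _ => by ring
  rw [h4] at h2
  have h5 := hell (y - z)
  have h6 : -(3 * r * C) ≤ inner ℝ (y - z) ξ := by
    have := (abs_le.1 (abs_real_inner_le_norm (y - z) ξ)).1
    have : ‖y - z‖ * ‖ξ‖ ≤ 3 * r * C := by gcongr
    linarith
  set Q := ∑ i, inner ℝ (y - z) (e i) ^ 2
  have h7 : r ^ 2 ≤ C * Q := le_trans (by gcongr) h5
  -- Once `K` is cancelled, `h2` bounds `4α²Q` by terms linear in `α`; division by `2α` leaves this.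
  have h8 : 2 * α * Q ≤ C ^ 2 * Fintype.card ι + 3 * r * C := by
    have : α * (2 * α * Q) ≤ α * (C ^ 2 * Fintype.card ι + 3 * r * C) := by nlinarith
    exact le_of_mul_le_mul_left this hα
  have h9 : 2 * α * r ^ 2 ≤ 2 * α * (C * Q) := by gcongr
  have h10 : C * (2 * α * Q) ≤ C * (C ^ 2 * Fintype.card ι + 3 * r * C) := by gcongr
  linarith

/-- The ball with diameter `zp` touches the sphere about `z` through `p` only at `p`. The
parallelogram law gives this. -/
theorem eq_of_norm_sub_midpoint_le {z p y : E}
    (h1 : ‖y - midpoint ℝ z p‖ ≤ ‖p - z‖ / 2) (h2 : ‖p - z‖ ≤ ‖y - z‖) : y = p := by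
  have ha : y - z = (y - midpoint ℝ z p) + (2⁻¹ : ℝ) • (p - z) := by
    rw [midpoint_eq_smul_add, invOf_eq_inv]; module
  have hb : y - p = (y - midpoint ℝ z p) - (2⁻¹ : ℝ) • (p - z) := by
    rw [midpoint_eq_smul_add, invOf_eq_inv]; module
  have hpar := parallelogram_law_with_norm ℝ (y - midpoint ℝ z p) ((2⁻¹ : ℝ) • (p - z))
  rw [← ha, ← hb, norm_smul] at hpar
  have hn : ‖(2⁻¹ : ℝ)‖ = 2⁻¹ := by norm_num
  rw [hn] at hpar
  have := norm_nonneg (y - p)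
  have := norm_nonneg (p - z)
  have := norm_nonneg (y - midpoint ℝ z p)
  have h0 : ‖y - p‖ = 0 := by nlinarith
  exact sub_eq_zero.1 (norm_eq_zero.1 h0)

/-- The strong maximum principle at a touching point of an interior ball. -/
theorem exists_eq_of_touching_ball [FiniteDimensional ℝ E] {ι : Type*} [Fintype ι] {C : ℝ}
    {u : E → ℝ} {c p : E} {ρ : ℝ} (hC : 0 < C) (hρ : 0 < ρ)
    (hu : ∀ y ∈ ball p ρ, ContDiffAt ℝ 2 u y) (hsub : ∀ y ∈ ball p ρ, IsSubsolutionAt ι C u y)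
    (hmax : ∀ y ∈ ball p ρ, u y ≤ u p) (hcp : c ≠ p) :
    ∃ y ∈ ball p ρ, y ≠ p ∧ ‖y - c‖ ≤ ‖p - c‖ ∧ u y = u p := by
  by_contra! hne
  set R := ‖p - c‖ with hR
  have hRpos : 0 < R := norm_pos_iff.2 (sub_ne_zero.2 hcp.symm)
  -- The cap `R / 2` keeps the small ball about `p` in the annulus between radii `R / 2` and `3R /
  -- 2` around `c`, where the barrier estimate holds; the cap `ρ / 2` keeps it inside the domain.
  set r := min (R / 2) (ρ / 2) with hrdef
  have hrpos : 0 < r := by positivity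
  have hrR : r ≤ R / 2 := min_le_left _ _
  have hrρ : r < ρ := (min_le_right _ _).trans_lt (by linarith)
  obtain ⟨α, hα, hbig⟩ : ∃ α : ℝ, 0 < α ∧
      C * (C ^ 2 * Fintype.card ι + 3 * (R / 2) * C) < 2 * α * (R / 2) ^ 2 := by
    refine ⟨(C * (C ^ 2 * Fintype.card ι + 3 * (R / 2) * C) + 1) / (2 * (R / 2) ^ 2),
      by positivity, ?_⟩
    have : 2 * ((C * (C ^ 2 * Fintype.card ι + 3 * (R / 2) * C) + 1) / (2 * (R / 2) ^ 2))
        * (R / 2) ^ 2 = C * (C ^ 2 * Fintype.card ι + 3 * (R / 2) * C) + 1 := by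
      field_simp
    rw [this]; linarith
  have hcont : ContinuousOn u (closedBall p r) := fun y hy =>
    (hu y (closedBall_subset_ball hrρ hy)).continuousAt.continuousWithinAt
  obtain ⟨δ, hδ, hδu⟩ : ∃ δ > 0, ∀ y ∈ sphere p r ∩ closedBall c R, u y ≤ u p - δ := by
    have hcomp : IsCompact (sphere p r ∩ closedBall c R) :=
      (isCompact_sphere p r).inter_right isClosed_closedBall
    rcases (sphere p r ∩ closedBall c R).eq_empty_or_nonempty with h | h
    · exact ⟨1, one_pos, by simp [h]⟩
    · obtain ⟨m, hm, hmm⟩ := hcomp.exists_isMaxOn h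
        (hcont.mono (Set.inter_subset_left.trans sphere_subset_closedBall))
      have hmball : m ∈ ball p ρ := closedBall_subset_ball hrρ (sphere_subset_closedBall hm.1)
      have hlt : u m < u p := lt_of_le_of_ne (hmax m hmball) (hne m hmball
        (by rintro rfl; simp at hm; linarith [hm.1]) (by simpa [dist_eq_norm] using hm.2))
      exact ⟨u p - u m, sub_pos.2 hlt, fun y hy => by have := hmm hy; simp at this; linarith⟩
  -- Coefficient `δ / 2`: since the Gaussian is at most `1`, the barrier cannot make up the loss `δ`
  -- on the part of the small sphere inside the ball about `c`. Outside that ball the Gaussian is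
  -- smaller than at `p`. Hence `v` attains its maximum in the interior.
  set v : E → ℝ := fun x => u x + δ / 2 * Real.exp (-α * ‖x - c‖ ^ 2) with hv
  have hvcont : ContinuousOn v (closedBall p r) := hcont.add (by fun_prop)
  obtain ⟨m, hm, hmm⟩ := (isCompact_closedBall p r).exists_isMaxOn
    (nonempty_closedBall.2 hrpos.le) hvcont
  have hvm : v p ≤ v m := hmm (mem_closedBall_self hrpos.le)
  have hmball : m ∈ ball p r := by
    by_contra hcon
    have hms : m ∈ sphere p r := by
      simp only [mem_ball, not_lt] at hcon
      exact le_antisymm hm hcon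
    by_cases hmc : ‖m - c‖ ≤ R
    · have h1 := hδu m ⟨hms, by simpa [dist_eq_norm] using hmc⟩
      have h2 : Real.exp (-α * ‖m - c‖ ^ 2) ≤ 1 :=
        Real.exp_le_one_iff.2 (by nlinarith [sq_nonneg ‖m - c‖])
      have h3 := Real.exp_pos (-α * ‖p - c‖ ^ 2)
      simp only [hv] at hvm
      nlinarith
    · have h1 := hmax m (closedBall_subset_ball hrρ hm)
      have h2 : Real.exp (-α * ‖m - c‖ ^ 2) < Real.exp (-α * ‖p - c‖ ^ 2) := by
        apply Real.exp_lt_exp.2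
        push Not at hmc
        have : ‖p - c‖ ^ 2 < ‖m - c‖ ^ 2 := by gcongr
        nlinarith
      simp only [hv] at hvm
      nlinarith
  have hmρ : m ∈ ball p ρ := ball_subset_ball hrρ.le hmball
  have hmp : ‖m - p‖ < r := by simpa [dist_eq_norm] using hmball
  refine not_isLocalMax_add_gaussian (z := c) (r := R / 2) hC (hu m hmρ) (hsub m hmρ)
    (half_pos hδ) hα (by positivity) ?_ ?_ hbig
    (hmm.isLocalMax (closedBall_mem_nhds_of_mem hmball))
  · have : ‖p - c‖ ≤ ‖m - c‖ + ‖m - p‖ := by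
      have := norm_sub_le (m - c) (m - p)
      simpa using this
    linarith
  · have : ‖m - c‖ ≤ ‖m - p‖ + ‖p - c‖ := norm_sub_le_norm_sub_add_norm_sub _ _ _
    linarith

/-- The strong maximum principle: a subsolution with a local maximum is locally constant. -/
theorem eventually_eq_of_isLocalMax [FiniteDimensional ℝ E] {ι : Type*} [Fintype ι] {C : ℝ}
    {u : E → ℝ} {p : E} (hC : 0 < C) (hu : ContDiffAt ℝ 2 u p)
    (hsub : ∀ᶠ y in 𝓝 p, IsSubsolutionAt ι C u y) (hmax : IsLocalMax u p) :
    ∀ᶠ y in 𝓝 p, u y = u p := by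
  have hev := (hu.eventually (by simp)).and (hsub.and hmax)
  obtain ⟨ρ, hρ, hball⟩ := Metric.eventually_nhds_iff_ball.1 hev
  -- With a quarter of `ρ`, both the ball about `z` and the later ball about the contact point `q`
  -- stay inside `ball p ρ`.
  have hρ4 : 0 < ρ / 4 := by positivity
  filter_upwards [ball_mem_nhds p hρ4] with z hz
  by_contra hzne
  have hzp : ‖p - z‖ < ρ / 4 := by simpa [dist_eq_norm, norm_sub_rev] using hz
  have hsubset : closedBall z (ρ / 4) ⊆ ball p ρ := by
    intro y hy
    simp only [mem_closedBall, mem_ball, dist_eq_norm] at *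
    have := norm_sub_le_norm_sub_add_norm_sub y z p
    linarith
  have hcont : ContinuousOn u (closedBall z (ρ / 4)) := fun y hy =>
    (hball y (hsubset hy)).1.continuousAt.continuousWithinAt
  have hcomp : IsCompact (closedBall z (ρ / 4) ∩ u ⁻¹' {u p}) :=
    (isCompact_closedBall z (ρ / 4)).of_isClosed_subset
      (hcont.preimage_isClosed_of_isClosed isClosed_closedBall isClosed_singleton)
      Set.inter_subset_left
  -- `q` is a point of the level set `u = u p` nearest to `z`.
  obtain ⟨q, hq, hqmin⟩ := hcomp.exists_isMinOn
    ⟨p, by simpa [dist_eq_norm] using hzp.le, rfl⟩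
    (f := fun y => ‖y - z‖) (by fun_prop)
  have hqp : u q = u p := hq.2
  have hqR : ‖q - z‖ ≤ ‖p - z‖ := hqmin ⟨by simpa [dist_eq_norm] using hzp.le, rfl⟩
  have hqz : q ≠ z := by rintro rfl; exact hzne hqp
  have hmem : ∀ y ∈ ball q (ρ / 4), y ∈ ball p ρ := by
    intro y hy
    simp only [mem_ball, dist_eq_norm] at *
    have h1 := norm_sub_le_norm_sub_add_norm_sub y q p
    have h2 := norm_sub_le_norm_sub_add_norm_sub q z p
    linarith
  have hmid : ‖q - midpoint ℝ z q‖ = ‖q - z‖ / 2 := by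
    rw [← dist_eq_norm, dist_right_midpoint, dist_eq_norm, norm_sub_rev]
    norm_num
    ring
  -- The ball is shrunk to the one with diameter `zq` because the touching lemma yields a point of
  -- the closed ball only. A point other than `q` in this smaller ball is strictly closer to `z`
  -- than `q`, against the choice of `q`.
  obtain ⟨y, hy, hyq, hyc, hyu⟩ := exists_eq_of_touching_ball (c := midpoint ℝ z q) hC hρ4
    (fun y hy => (hball y (hmem y hy)).1) (fun y hy => (hball y (hmem y hy)).2.1)
    (fun y hy => by rw [hqp]; exact (hball y (hmem y hy)).2.2)
    (by simpa using hqz.symm)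
  rw [hmid] at hyc
  refine hyq (eq_of_norm_sub_midpoint_le hyc ?_)
  by_contra! hlt
  refine hlt.not_ge (hqmin ⟨?_, hyu.trans hqp⟩)
  simp only [mem_closedBall, dist_eq_norm]
  linarith

end MaximumPrinciple

/-! ### Local geometry of submanifolds -/

section LocalGeometry

variable {V W : Type*} [NormedAddCommGroup V] [NormedSpace ℝ V]
  [NormedAddCommGroup W] [NormedSpace ℝ W]

instance instNormedAddCommGroupBilinear {V' : Type*} [NormedAddCommGroup V']
    [NormedSpace ℝ V'] : NormedAddCommGroup (V →L[ℝ] V' →L[ℝ] W) :=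
  ContinuousLinearMap.toNormedAddCommGroup

instance instNormedSpaceBilinear {V' : Type*} [NormedAddCommGroup V']
    [NormedSpace ℝ V'] : NormedSpace ℝ (V →L[ℝ] V' →L[ℝ] W) :=
  ContinuousLinearMap.toNormedSpace

instance instNormedAddCommGroupTrilinear :
    NormedAddCommGroup (W →L[ℝ] W →L[ℝ] W →L[ℝ] ℝ) :=
  ContinuousLinearMap.toNormedAddCommGroup

/-- The constant is the minimum of `B v v` over the compact unit sphere, extended by homogeneity. An
empty sphere means that the space is zero. -/
theorem exists_coercive [FiniteDimensional ℝ W] {B : W →L[ℝ] W →L[ℝ] ℝ}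
    (hB : ∀ v, v ≠ 0 → 0 < B v v) : ∃ c > 0, ∀ v, c * ‖v‖ ^ 2 ≤ B v v := by
  rcases (sphere (0 : W) 1).eq_empty_or_nonempty with h | h
  · refine ⟨1, one_pos, fun v => ?_⟩
    have hv : v = 0 := by
      by_contra hv
      have : ‖v‖⁻¹ • v ∈ sphere (0 : W) 1 := by
        simp [norm_smul, inv_mul_cancel₀ (norm_ne_zero_iff.2 hv)]
      rw [h] at this
      exact this
    simp [hv]
  · obtain ⟨m, hm, hmin⟩ := (isCompact_sphere (0 : W) 1).exists_isMinOn h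
      (f := fun v => B v v) (by fun_prop)
    have hm0 : m ≠ 0 := by rintro rfl; simp at hm
    refine ⟨B m m, hB m hm0, fun v => ?_⟩
    rcases eq_or_ne v 0 with rfl | hv
    · simp
    have hvn : ‖v‖ ≠ 0 := norm_ne_zero_iff.2 hv
    have h1 : ‖v‖⁻¹ • v ∈ sphere (0 : W) 1 := by
      simp [norm_smul, inv_mul_cancel₀ hvn]
    have h2 : B m m ≤ B (‖v‖⁻¹ • v) (‖v‖⁻¹ • v) := hmin h1
    simp only [map_smul, smul_apply, smul_eq_mul] at h2
    calc B m m * ‖v‖ ^ 2 ≤ (‖v‖⁻¹ * (‖v‖⁻¹ * B v v)) * ‖v‖ ^ 2 := by gcongr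
      _ = B v v := by field_simp

theorem abs_bilin_le (B : W →L[ℝ] W →L[ℝ] ℝ) (v w : W) : |B v w| ≤ ‖B‖ * ‖v‖ * ‖w‖ :=
  B.le_opNorm₂ v w

/-- A perturbation of norm below `c / 2` leaves half of the coercivity constant `c` at `p`. -/
theorem eventually_coercive [FiniteDimensional ℝ W] {Y : Type*} [TopologicalSpace Y]
    {B : Y → W →L[ℝ] W →L[ℝ] ℝ} {p : Y} (hB : ContinuousAt B p)
    (hpos : ∀ v, v ≠ 0 → 0 < B p v v) :
    ∃ K > 0, ∀ᶠ y in 𝓝 p, ∀ v, ‖v‖ ^ 2 ≤ K * B y v v := by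
  obtain ⟨c, hc, hcB⟩ := exists_coercive hpos
  refine ⟨2 / c, by positivity, ?_⟩
  filter_upwards [Metric.continuousAt_iff'.1 hB (c / 2) (by positivity)] with y hy v
  rw [dist_eq_norm] at hy
  have h1 := (abs_le.1 (abs_bilin_le (B y - B p) v v)).1
  have h2 : ‖B y - B p‖ * ‖v‖ * ‖v‖ ≤ c / 2 * ‖v‖ * ‖v‖ := by gcongr
  have h3 := hcB v
  simp only [sub_apply] at h1
  have h4 : c / 2 * ‖v‖ ^ 2 ≤ B y v v := by nlinarith
  calc ‖v‖ ^ 2 = 2 / c * (c / 2 * ‖v‖ ^ 2) := by field_simp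
    _ ≤ _ := by gcongr

theorem eventually_norm_le {Y Z : Type*} [TopologicalSpace Y] [SeminormedAddCommGroup Z]
    {f : Y → Z} {p : Y} (hf : ContinuousAt f p) : ∃ K : ℝ, ∀ᶠ y in 𝓝 p, ‖f y‖ ≤ K :=
  ⟨‖f p‖ + 1, (hf.norm.eventually_lt_const (lt_add_one _)).mono fun _ h => h.le⟩

theorem continuousAt_flip {Y W' : Type*} [TopologicalSpace Y] [NormedAddCommGroup W']
    [NormedSpace ℝ W'] {f : Y → V →L[ℝ] W' →L[ℝ] ℝ} {p : Y} (hf : ContinuousAt f p) :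
    ContinuousAt (fun y => (f y).flip) p :=
  (ContinuousLinearMap.flipₗᵢ ℝ V W' ℝ).continuous.continuousAt.comp hf

theorem sq_le_mul_mono {a b c K : ℝ} (hb : 0 < b) (h : a ^ 2 ≤ b * c) (hbK : b ≤ K) :
    a ^ 2 ≤ K * c := by
  have hc : 0 ≤ c := by
    by_contra! hc
    nlinarith [sq_nonneg a]
  exact h.trans (by gcongr)

/-- Bounds by `K` on the geometry at `y` of the parametrized submanifold `X` of a space with the
metric `G`. -/
structure GeometryBound (G : W → W →L[ℝ] W →L[ℝ] ℝ) (X : V → W) (K : ℝ) (y : V) : Prop where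
  metric : ‖G (X y)‖ ≤ K
  fderiv_metric : ‖fderiv ℝ G (X y)‖ ≤ K
  fderiv_map : ‖fderiv ℝ X y‖ ≤ K
  fderiv_fderiv_map : ‖fderiv ℝ (fderiv ℝ X) y‖ ≤ K
  coercive : ∀ w, ‖w‖ ^ 2 ≤ K * G (X y) w w
  coercive_induced : ∀ v, ‖v‖ ^ 2 ≤ K * G (X y) (fderiv ℝ X y v) (fderiv ℝ X y v)

theorem GeometryBound.pos {G : W → W →L[ℝ] W →L[ℝ] ℝ} {X : V → W} {K : ℝ} {y : V}
    (h : GeometryBound G X K y) (hK : 0 < K) {w : W} (hw : w ≠ 0) : 0 < G (X y) w w := by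
  have h1 := h.coercive w
  have h2 : 0 < ‖w‖ := norm_pos_iff.2 hw
  by_contra! h3
  nlinarith [pow_pos h2 2]

theorem GeometryBound.mono {G : W → W →L[ℝ] W →L[ℝ] ℝ} {X : V → W} {K K' : ℝ} {y : V}
    (h : GeometryBound G X K y) (hK : 0 < K) (hKK' : K ≤ K') : GeometryBound G X K' y where
  metric := h.metric.trans hKK'
  fderiv_metric := h.fderiv_metric.trans hKK'
  fderiv_map := h.fderiv_map.trans hKK'
  fderiv_fderiv_map := h.fderiv_fderiv_map.trans hKK'
  coercive w := sq_le_mul_mono hK (h.coercive w) hKK'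
  coercive_induced v := sq_le_mul_mono hK (h.coercive_induced v) hKK'

/-- The maximum principle needs constants uniform near `p`. They come from continuity of the first
derivative of `G` and the first two of `X`, and from coercivity of `G` and of the induced form, the
latter by injectivity of `DX`. -/
theorem eventually_geometryBound [FiniteDimensional ℝ V] [FiniteDimensional ℝ W]
    {G : W → W →L[ℝ] W →L[ℝ] ℝ} {X : V → W} {p : V} (hG : ContDiffAt ℝ 1 G (X p))
    (hX : ContDiffAt ℝ 2 X p) (hpos : ∀ w, w ≠ 0 → 0 < G (X p) w w)
    (hinj : Function.Injective (fderiv ℝ X p)) :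
    ∃ K > 0, ∀ᶠ y in 𝓝 p, GeometryBound G X K y := by
  have hXc := hX.continuousAt
  have hdX : ContDiffAt ℝ 1 (fderiv ℝ X) p := hX.fderiv_right le_rfl
  have hddX : ContDiffAt ℝ 0 (fderiv ℝ (fderiv ℝ X)) p := hdX.fderiv_right le_rfl
  have hdG : ContDiffAt ℝ 0 (fderiv ℝ G) (X p) := hG.fderiv_right le_rfl
  have hGX : ContinuousAt (fun y => G (X y)) p := hG.continuousAt.comp hXc
  obtain ⟨K1, h1⟩ := eventually_norm_le hGX
  obtain ⟨K2, h2⟩ := eventually_norm_le (hdG.continuousAt.comp hXc)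
  obtain ⟨K3, h3⟩ := eventually_norm_le hdX.continuousAt
  obtain ⟨K4, h4⟩ := eventually_norm_le hddX.continuousAt
  obtain ⟨K5, hK5, h5⟩ := eventually_coercive hGX hpos
  have hind : ContinuousAt
      (fun y => (G (X y)).bilinearComp (fderiv ℝ X y) (fderiv ℝ X y)) p := by
    have := hdX.continuousAt
    have hc : ContinuousAt (fun y => (G (X y)).comp (fderiv ℝ X y)) p := hGX.clm_comp this
    exact (continuousAt_flip ((continuousAt_flip hc).clm_comp this))
  obtain ⟨K6, hK6, h6⟩ := eventually_coercive hind (fun v hv => by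
    simpa using hpos _ (fun h => hv (hinj (by simpa using h))))
  set K := 1 + |K1| + |K2| + |K3| + |K4| + K5 + K6 with hK
  have hle : K1 ≤ K ∧ K2 ≤ K ∧ K3 ≤ K ∧ K4 ≤ K ∧ K5 ≤ K ∧ K6 ≤ K ∧ 0 < K := by
    refine ⟨?_, ?_, ?_, ?_, ?_, ?_, ?_⟩ <;>
    linarith [le_abs_self K1, le_abs_self K2, le_abs_self K3, le_abs_self K4, abs_nonneg K1,
      abs_nonneg K2, abs_nonneg K3, abs_nonneg K4]
  obtain ⟨l1, l2, l3, l4, l5, l6, l0⟩ := hle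
  refine ⟨K, l0, ?_⟩
  filter_upwards [h1, h2, h3, h4, h5, h6] with y g1 g2 g3 g4 g5 g6
  exact ⟨g1.trans l1, g2.trans l2, g3.trans l3, g4.trans l4, fun w => sq_le_mul_mono hK5 (g5 w) l5,
    fun v => sq_le_mul_mono hK6 (g6 v) l6⟩

end LocalGeometry

/-! ### Pointwise estimates: Christoffel vectors, tangential parts, mean curvature -/

section Pointwise

variable {V W : Type*} [NormedAddCommGroup V] [NormedSpace ℝ V]
  [NormedAddCommGroup W] [NormedSpace ℝ W]

/-- An orthogonal basis of the pulled back form exists by symmetry, and positivity allows it to be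
normalized. -/
theorem exists_isInducedOrthonormal [FiniteDimensional ℝ V] {G : W → W →L[ℝ] W →L[ℝ] ℝ}
    {X : V → W} {y : V} (hsymm : ∀ a b, G (X y) a b = G (X y) b a)
    (hpos : ∀ w, w ≠ 0 → 0 < G (X y) w w) (hinj : Function.Injective (fderiv ℝ X y)) :
    ∃ e : Basis (Fin (finrank ℝ V)) ℝ V, IsInducedOrthonormal G X y e := by
  let B : LinearMap.BilinForm ℝ V := LinearMap.mk₂ ℝ
    (fun v w => G (X y) (fderiv ℝ X y v) (fderiv ℝ X y w)) (by simp) (by simp) (by simp) (by simp)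
  have hB : ∀ v w, B v w = G (X y) (fderiv ℝ X y v) (fderiv ℝ X y w) := fun _ _ => rfl
  obtain ⟨v, hv⟩ := LinearMap.BilinForm.exists_orthogonal_basis (B := B) ⟨fun a b => hsymm _ _⟩
  have hpos' : ∀ i, 0 < B (v i) (v i) := fun i =>
    hpos _ fun h => v.ne_zero i (hinj (by simpa using h))
  have hu : ∀ i, IsUnit (Real.sqrt (B (v i) (v i)))⁻¹ := fun i =>
    (inv_ne_zero (Real.sqrt_pos.2 (hpos' i)).ne').isUnit
  refine ⟨v.isUnitSMul hu, fun i j => ?_⟩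
  rw [← hB, Basis.isUnitSMul_apply, Basis.isUnitSMul_apply]
  simp only [map_smul, LinearMap.smul_apply, smul_eq_mul]
  split_ifs with hij
  · subst hij
    have h1 := Real.mul_self_sqrt (hpos' i).le
    have h2 := (Real.sqrt_pos.2 (hpos' i)).ne'
    field_simp
    linarith
  · have : B (v i) (v j) = 0 := hv hij
    simp [this]

theorem GeometryBound.norm_christoffel_le [FiniteDimensional ℝ W] {G : W → W →L[ℝ] W →L[ℝ] ℝ}
    {X : V → W} {K : ℝ} {y : V} (h : GeometryBound G X K y) (hK : 0 < K) (a b : W) :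
    ‖christoffel G (X y) a b‖ ≤ 2 * K ^ 2 * ‖a‖ * ‖b‖ := by
  have hspec := christoffel_spec G (X y) a b (fun v hv => h.pos hK hv)
  set c := christoffel G (X y) a b
  have h1 := h.coercive c
  have h2 := hspec c
  have hb : ∀ u v w : W, |fderiv ℝ G (X y) u v w| ≤ K * ‖u‖ * ‖v‖ * ‖w‖ := fun u v w =>
    calc |fderiv ℝ G (X y) u v w| ≤ ‖fderiv ℝ G (X y) u‖ * ‖v‖ * ‖w‖ := abs_bilin_le _ _ _
      _ ≤ (‖fderiv ℝ G (X y)‖ * ‖u‖) * ‖v‖ * ‖w‖ := by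
        gcongr; exact ContinuousLinearMap.le_opNorm _ _
      _ ≤ _ := by gcongr; exact h.fderiv_metric
  have b1 := (abs_le.1 (hb a b c)).2
  have b2 := (abs_le.1 (hb b a c)).2
  have b3 := (abs_le.1 (hb c a b)).1
  have h3 : 2 * G (X y) c c ≤ 3 * (K * ‖a‖ * ‖b‖) * ‖c‖ := by
    rw [h2]; linarith
  -- Testing Koszul on `c` itself bounds `‖c‖²` by a multiple of `‖c‖`; the negated goal makes `‖c‖`
  -- positive, so it can be cancelled.
  by_contra! hlt
  have hc : 0 < ‖c‖ := lt_of_le_of_lt (by positivity) hlt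
  have h4 : 2 * ‖c‖ ^ 2 ≤ K * (3 * (K * ‖a‖ * ‖b‖) * ‖c‖) := by
    calc 2 * ‖c‖ ^ 2 ≤ K * (2 * G (X y) c c) := by linarith
      _ ≤ _ := by gcongr
  have h5 : ‖c‖ * (2 * K ^ 2 * ‖a‖ * ‖b‖) < ‖c‖ * ‖c‖ := by gcongr
  have h6 : 0 ≤ ‖c‖ * (K ^ 2 * ‖a‖ * ‖b‖) := by positivity
  nlinarith

/-- Pairing `v` with its tangential part `DX ξ` removes the normal part, so coercivity of the
induced form bounds `‖ξ‖²` by `K³ ‖v‖ ‖ξ‖`. -/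
theorem GeometryBound.exists_tangential [FiniteDimensional ℝ W] {G : W → W →L[ℝ] W →L[ℝ] ℝ}
    {X : V → W} {K : ℝ} {y : V} (h : GeometryBound G X K y) (hK : 0 < K) (v : W) :
    ∃ ξ : V, fderiv ℝ X y ξ = v - normalPart (G (X y))
      (LinearMap.range (fderiv ℝ X y).toLinearMap) v ∧ ‖ξ‖ ≤ K ^ 3 * ‖v‖ := by
  have hspec := normalPart_spec (G (X y)) (fun v hv => h.pos hK hv)
    (LinearMap.range (fderiv ℝ X y).toLinearMap) v
  set w := normalPart (G (X y)) (LinearMap.range (fderiv ℝ X y).toLinearMap) v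
  obtain ⟨⟨ξ, hξ⟩, hw⟩ := hspec
  have hξ' : fderiv ℝ X y ξ = v - w := hξ
  refine ⟨ξ, hξ', ?_⟩
  have h1 := h.coercive_induced ξ
  have h2 : G (X y) w (fderiv ℝ X y ξ) = 0 := hw _ ⟨ξ, rfl⟩
  have h3 : G (X y) (fderiv ℝ X y ξ) (fderiv ℝ X y ξ) = G (X y) v (fderiv ℝ X y ξ) := by
    have : G (X y) (fderiv ℝ X y ξ) (fderiv ℝ X y ξ) = G (X y) (v - w) (fderiv ℝ X y ξ) := by
      rw [← hξ']
    rw [this, map_sub, sub_apply, h2, sub_zero]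
  have h4 : G (X y) v (fderiv ℝ X y ξ) ≤ K * ‖v‖ * (K * ‖ξ‖) :=
    calc G (X y) v (fderiv ℝ X y ξ) ≤ ‖G (X y)‖ * ‖v‖ * ‖fderiv ℝ X y ξ‖ :=
          (le_abs_self _).trans (abs_bilin_le _ _ _)
      _ ≤ K * ‖v‖ * (K * ‖ξ‖) := by
        gcongr
        · exact h.metric
        · exact (ContinuousLinearMap.le_opNorm _ _).trans (by gcongr; exact h.fderiv_map)
  rw [h3] at h1
  have h5 : ‖ξ‖ ^ 2 ≤ K * (K * ‖v‖ * (K * ‖ξ‖)) := h1.trans (by gcongr)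
  by_contra! hlt
  have hpos : 0 < ‖ξ‖ := lt_of_le_of_lt (by positivity) hlt
  have h6 : ‖ξ‖ * (K ^ 3 * ‖v‖) < ‖ξ‖ * ‖ξ‖ := by gcongr
  nlinarith

/-- The covariant derivative `∇_v (DX v)` along `X`. -/
def covariantAcceleration (G : W → W →L[ℝ] W →L[ℝ] ℝ) (X : V → W) (y v : V) : W :=
  fderiv ℝ (fderiv ℝ X) y v v + christoffel G (X y) (fderiv ℝ X y v) (fderiv ℝ X y v)

theorem GeometryBound.norm_covariantAcceleration_le [FiniteDimensional ℝ W]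
    {G : W → W →L[ℝ] W →L[ℝ] ℝ} {X : V → W} {K : ℝ} {y : V} (h : GeometryBound G X K y)
    (hK : 0 < K) (v : V) : ‖covariantAcceleration G X y v‖ ≤ (K + 2 * K ^ 4) * ‖v‖ ^ 2 := by
  have h1 : ‖fderiv ℝ (fderiv ℝ X) y v v‖ ≤ K * ‖v‖ * ‖v‖ :=
    (ContinuousLinearMap.le_opNorm₂ _ _ _).trans (by gcongr; exact h.fderiv_fderiv_map)
  have h2 : ‖fderiv ℝ X y v‖ ≤ K * ‖v‖ :=
    (ContinuousLinearMap.le_opNorm _ _).trans (by gcongr; exact h.fderiv_map)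
  have h3 := h.norm_christoffel_le hK (fderiv ℝ X y v) (fderiv ℝ X y v)
  have h4 : 2 * K ^ 2 * ‖fderiv ℝ X y v‖ * ‖fderiv ℝ X y v‖
      ≤ 2 * K ^ 2 * (K * ‖v‖) * (K * ‖v‖) := by gcongr
  refine (norm_add_le _ _).trans ?_
  nlinarith

theorem GeometryBound.norm_sq_le_of_isInducedOrthonormal {G : W → W →L[ℝ] W →L[ℝ] ℝ}
    {X : V → W} {K : ℝ} {y : V} (h : GeometryBound G X K y) {n : ℕ} {e : Basis (Fin n) ℝ V}
    (he : IsInducedOrthonormal G X y e) (i : Fin n) : ‖e i‖ ^ 2 ≤ K := by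
  have h1 := h.coercive_induced (e i)
  have h2 := he i i
  rw [if_pos rfl] at h2
  rw [h2, mul_one] at h1
  exact h1

/-- Vanishing of the summed normal parts is exactly tangency of the total acceleration; its preimage
`ξ` becomes the drift of the elliptic equation. -/
theorem GeometryBound.exists_sum_tangential [FiniteDimensional ℝ W]
    {G : W → W →L[ℝ] W →L[ℝ] ℝ} {X : V → W} {K : ℝ} {y : V} (h : GeometryBound G X K y)
    (hK : 0 < K) {n : ℕ} {e : Basis (Fin n) ℝ V} (he : IsInducedOrthonormal G X y e)
    (hH : ∑ i, localSecondFundamentalForm G X y (e i) (e i) = 0) :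
    ∃ ξ : V, fderiv ℝ X y ξ = ∑ i, covariantAcceleration G X y (e i) ∧
      ‖ξ‖ ≤ n * (K ^ 3 * ((K + 2 * K ^ 4) * K)) := by
  choose ξ hξ hξn using fun i => h.exists_tangential hK (covariantAcceleration G X y (e i))
  refine ⟨∑ i, ξ i, ?_, ?_⟩
  · rw [map_sum]
    simp only [hξ, Finset.sum_sub_distrib]
    rw [sub_eq_self]
    exact hH
  · have : ∀ i ∈ Finset.univ, ‖ξ i‖ ≤ K ^ 3 * ((K + 2 * K ^ 4) * K) := fun i _ =>
      (hξn i).trans (by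
        gcongr
        exact (h.norm_covariantAcceleration_le hK (e i)).trans
          (by gcongr; exact h.norm_sq_le_of_isInducedOrthonormal he i))
    simpa using norm_sum_le_of_le _ this

end Pointwise

/-! ### Ellipticity of the trace over an induced orthonormal basis -/

section Ellipticity

variable {V W : Type*} [NormedAddCommGroup V] [InnerProductSpace ℝ V]
  [NormedAddCommGroup W] [NormedSpace ℝ W]

/-- Write `v = ∑ c i • e i`. Then `‖v‖² = ∑ c i ⟨v, e i⟩`, and `∑ (c i)²` is the induced square of
`v`, at most `K³ ‖v‖²`; Cauchy–Schwarz finishes. -/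
theorem GeometryBound.norm_sq_le_sum_inner {G : W → W →L[ℝ] W →L[ℝ] ℝ} {X : V → W} {K : ℝ}
    {y : V} (h : GeometryBound G X K y) (hK : 0 < K) {n : ℕ} {e : Basis (Fin n) ℝ V}
    (he : IsInducedOrthonormal G X y e) (v : V) :
    ‖v‖ ^ 2 ≤ K ^ 3 * ∑ i, inner ℝ v (e i) ^ 2 := by
  set c := fun i => e.repr v i with hc
  have hv : v = ∑ i, c i • e i := (e.sum_repr v).symm
  have h1 : ∑ i, c i ^ 2 = G (X y) (fderiv ℝ X y v) (fderiv ℝ X y v) := by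
    conv_rhs => rw [hv]
    simp only [map_sum, map_smul, sum_apply, smul_apply, smul_eq_mul]
    refine Finset.sum_congr rfl fun i _ => ?_
    simp [he _ _, pow_two]
  have h2 : G (X y) (fderiv ℝ X y v) (fderiv ℝ X y v) ≤ K * (K * ‖v‖) * (K * ‖v‖) := by
    have h3 : ‖fderiv ℝ X y v‖ ≤ K * ‖v‖ :=
      (ContinuousLinearMap.le_opNorm _ _).trans (by gcongr; exact h.fderiv_map)
    refine (le_abs_self _).trans ((abs_bilin_le _ _ _).trans ?_)
    gcongr
    exact h.metric
  have h3 : ‖v‖ ^ 2 = ∑ i, c i * inner ℝ v (e i) := by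
    rw [← real_inner_self_eq_norm_sq]
    conv_lhs => rw [hv, sum_inner, ← hv]
    exact Finset.sum_congr rfl fun i _ => by
      rw [real_inner_smul_left, real_inner_comm]
  have h4 := Finset.sum_mul_sq_le_sq_mul_sq Finset.univ c (fun i => inner ℝ v (e i))
  rw [← h3, h1] at h4
  set Q := ∑ i, inner ℝ v (e i) ^ 2 with hQ
  have hQ0 : 0 ≤ Q := Finset.sum_nonneg fun i _ => sq_nonneg _
  by_contra! hlt
  have hpos : 0 < ‖v‖ ^ 2 := lt_of_le_of_lt (by positivity) hlt
  have h5 : (‖v‖ ^ 2) ^ 2 ≤ (K * (K * ‖v‖) * (K * ‖v‖)) * Q := h4.trans (by gcongr)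
  have h6 : ‖v‖ ^ 2 * (K ^ 3 * Q) < ‖v‖ ^ 2 * ‖v‖ ^ 2 := by gcongr
  nlinarith

end Ellipticity

/-! ### The elliptic inequality for the `t`-component -/

section SplitLocal

variable {V E : Type*} [NormedAddCommGroup V] [InnerProductSpace ℝ V]
  [NormedAddCommGroup E] [NormedSpace ℝ E]

theorem fderiv_bilinear_apply {W : Type*} [NormedAddCommGroup W] [NormedSpace ℝ W]
    {G : W → W →L[ℝ] W →L[ℝ] ℝ} {q : W} (hG : DifferentiableAt ℝ G q) (a b c : W) :
    fderiv ℝ (fun q => G q a b) q c = fderiv ℝ G q c a b := by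
  have h1 : HasFDerivAt (fun q => G q a b) (((ContinuousLinearMap.apply ℝ ℝ b).comp
      (ContinuousLinearMap.apply ℝ (W →L[ℝ] ℝ) a)).comp (fderiv ℝ G q)) q :=
    ((ContinuousLinearMap.apply ℝ ℝ b).comp
      (ContinuousLinearMap.apply ℝ (W →L[ℝ] ℝ) a)).hasFDerivAt.comp q hG.hasFDerivAt
  rw [h1.fderiv]
  rfl

/-- `G` has the form `β dt² + γ` at `q = (t, y)`, with `γ` a form on the second factor. -/
def IsSplitAt (β : ℝ → ℝ) (G : ℝ × E → ℝ × E →L[ℝ] ℝ × E →L[ℝ] ℝ) (q : ℝ × E) : Prop :=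
  ∀ a b, G q a b = β q.1 * (a.1 * b.1) + G q (0, a.2) (0, b.2)

theorem IsSplitAt.apply_vertical {β : ℝ → ℝ} {G : ℝ × E → ℝ × E →L[ℝ] ℝ × E →L[ℝ] ℝ}
    {q : ℝ × E} (h : IsSplitAt β G q) (a : ℝ × E) : G q a (1, 0) = β q.1 * a.1 := by
  rw [h a (1, 0)]
  have : ((0 : ℝ), (0 : E)) = 0 := rfl
  simp [this]

theorem hasFDerivAt_comp_fst {β : ℝ → ℝ} {q : ℝ × E} (hβ : DifferentiableAt ℝ β q.1) :
    HasFDerivAt (fun q : ℝ × E => β q.1)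
      (deriv β q.1 • ContinuousLinearMap.fst ℝ ℝ E) q := by
  have h1 : HasFDerivAt (fun q : ℝ × E => q.1) (ContinuousLinearMap.fst ℝ ℝ E) q :=
    (ContinuousLinearMap.fst ℝ ℝ E).hasFDerivAt
  exact hβ.hasDerivAt.comp_hasFDerivAt q h1

theorem fderiv_apply_vertical {β : ℝ → ℝ} {G : ℝ × E → ℝ × E →L[ℝ] ℝ × E →L[ℝ] ℝ} {q : ℝ × E}
    (hG : DifferentiableAt ℝ G q) (hβ : DifferentiableAt ℝ β q.1)
    (hsplit : ∀ᶠ q' in 𝓝 q, IsSplitAt β G q') (a c : ℝ × E) :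
    fderiv ℝ G q c a (1, 0) = deriv β q.1 * c.1 * a.1 := by
  rw [← fderiv_bilinear_apply hG]
  have h1 : (fun q => G q a (1, 0)) =ᶠ[𝓝 q] fun q => β q.1 * a.1 :=
    hsplit.mono fun q' h => h.apply_vertical a
  rw [h1.fderiv_eq, ((hasFDerivAt_comp_fst hβ).mul_const a.1).fderiv]
  simp [mul_comm]

theorem fderiv_vertical_apply {β : ℝ → ℝ} {G : ℝ × E → ℝ × E →L[ℝ] ℝ × E →L[ℝ] ℝ} {q : ℝ × E}
    (hG : DifferentiableAt ℝ G q) (hβ : DifferentiableAt ℝ β q.1)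
    (hsplit : ∀ᶠ q' in 𝓝 q, IsSplitAt β G q') (a : ℝ × E) :
    fderiv ℝ G q (1, 0) a a = deriv β q.1 * a.1 ^ 2
      + fderiv ℝ G q (1, 0) (0, a.2) (0, a.2) := by
  rw [← fderiv_bilinear_apply hG, ← fderiv_bilinear_apply hG (0, a.2)]
  have h1 : (fun q => G q a a) =ᶠ[𝓝 q]
      fun q => β q.1 * (a.1 * a.1) + G q (0, a.2) (0, a.2) := hsplit.mono fun q' h => h a a
  have h2 : DifferentiableAt ℝ (fun q => G q (0, a.2) (0, a.2)) q := by fun_prop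
  rw [h1.fderiv_eq, (((hasFDerivAt_comp_fst hβ).mul_const (a.1 * a.1)).fun_add
    h2.hasFDerivAt).fderiv]
  simp only [add_apply, smul_apply, ContinuousLinearMap.coe_fst', smul_eq_mul]
  ring

/-- Koszul tested on `∂_t`: the pairing `G(a, ∂_t) = β a^t` sees only `β`, so the two equal first
terms give `2β'(a^t)²`, and the third removes one copy together with the `t`-derivative of the
`F`-part. -/
theorem christoffel_vertical [FiniteDimensional ℝ E] {β : ℝ → ℝ} {G : ℝ × E → ℝ × E →L[ℝ] ℝ × E →L[ℝ] ℝ} {q : ℝ × E}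
    (hG : DifferentiableAt ℝ G q) (hβ : DifferentiableAt ℝ β q.1)
    (hsplit : ∀ᶠ q' in 𝓝 q, IsSplitAt β G q') (hpos : ∀ v, v ≠ 0 → 0 < G q v v) (a : ℝ × E) :
    2 * (β q.1 * (christoffel G q a a).1) = deriv β q.1 * a.1 ^ 2
      - fderiv ℝ G q (1, 0) (0, a.2) (0, a.2) := by
  have h := christoffel_spec G q a a hpos (1, 0)
  rw [hsplit.self_of_nhds.apply_vertical, fderiv_apply_vertical hG hβ hsplit,
    fderiv_vertical_apply hG hβ hsplit] at h
  rw [h]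
  ring

theorem fderiv_clm_comp_fderiv {X : V → ℝ × E} {y : V} (hX : ContDiffAt ℝ 2 X y)
    (L : ℝ × E →L[ℝ] ℝ) :
    (∀ v, fderiv ℝ (fun y => L (X y)) y v = L (fderiv ℝ X y v)) ∧
    ∀ v w, fderiv ℝ (fderiv ℝ (fun y => L (X y))) y v w = L (fderiv ℝ (fderiv ℝ X) y v w) := by
  have h1 : fderiv ℝ (fun y => L (X y)) =ᶠ[𝓝 y]
      fun z => ContinuousLinearMap.compL ℝ V (ℝ × E) ℝ L (fderiv ℝ X z) := by
    filter_upwards [hX.eventually (by simp)] with z hz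
    exact (L.hasFDerivAt.comp z (hz.differentiableAt two_ne_zero).hasFDerivAt).fderiv
  refine ⟨fun v => by rw [h1.self_of_nhds]; rfl, fun v w => ?_⟩
  have h2 : DifferentiableAt ℝ (fderiv ℝ X) y :=
    (hX.fderiv_right (m := 1) le_rfl).differentiableAt one_ne_zero
  have h3 : HasFDerivAt (fun z => ContinuousLinearMap.compL ℝ V (ℝ × E) ℝ L (fderiv ℝ X z)) _ y :=
    (ContinuousLinearMap.compL ℝ V (ℝ × E) ℝ L).hasFDerivAt.comp y h2.hasFDerivAt
  rw [h1.fderiv_eq, h3.fderiv]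
  rfl

/-- The ellipticity constant of the equation for the first component of a minimal submanifold of
dimension `n` with `GeometryBound` `K`. -/
def subsolutionConstant (n : ℕ) (K : ℝ) : ℝ :=
  -- `1 + K` bounds `e i`, `K ^ 3` is the ellipticity constant, and the last two terms bound the two
  -- parts of the drift.
  1 + K + K ^ 3 + n * (K ^ 3 * ((K + 2 * K ^ 4) * K)) + n * K ^ 3

theorem isSubsolutionAt_of_localMeanCurvatureZero [FiniteDimensional ℝ V] [FiniteDimensional ℝ E] {β : ℝ → ℝ}
    {G : ℝ × E → ℝ × E →L[ℝ] ℝ × E →L[ℝ] ℝ} {X : V → ℝ × E} {K σ : ℝ} {y : V}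
    (h : GeometryBound G X K y) (hK : 0 < K) (hX : ContDiffAt ℝ 2 X y)
    (hG : DifferentiableAt ℝ G (X y)) (hβ : DifferentiableAt ℝ β (X y).1)
    (hβ0 : 0 < β (X y).1) (hβK : |deriv β (X y).1 / β (X y).1| ≤ K)
    (hsplit : ∀ᶠ q in 𝓝 (X y), IsSplitAt β G q) (hsymm : ∀ a b, G (X y) a b = G (X y) b a)
    (hmono : ∀ w, 0 ≤ σ * fderiv ℝ G (X y) (1, 0) (0, w) (0, w))
    (hH : LocalMeanCurvatureZero G X y) :
    IsSubsolutionAt (Fin (finrank ℝ V)) (subsolutionConstant (finrank ℝ V) K)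
      (fun y => σ * (X y).1) y := by
  have hpos : ∀ w, w ≠ 0 → 0 < G (X y) w w := fun w hw => h.pos hK hw
  have hinj : Function.Injective (fderiv ℝ X y) := by
    rw [injective_iff_map_eq_zero]
    intro v hv
    have := h.coercive_induced v
    simpa [hv] using this
  obtain ⟨e, he⟩ := exists_isInducedOrthonormal hsymm hpos hinj
  obtain ⟨ξ, hξ, hξn⟩ := h.exists_sum_tangential hK he (hH e he)
  obtain ⟨hD, hDD⟩ := fderiv_clm_comp_fderiv hX (σ • ContinuousLinearMap.fst ℝ ℝ E)
  simp only [smul_apply, ContinuousLinearMap.coe_fst', smul_eq_mul] at hD hDD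
  set b := β (X y).1 with hb
  set b' := deriv β (X y).1 with hb'
  set d := fun i => (fderiv ℝ X y (e i)).1 with hd
  have hen : ∀ i, ‖e i‖ ^ 2 ≤ K := h.norm_sq_le_of_isInducedOrthonormal he
  set η := ∑ i, d i • e i with hη
  have hηn : ‖η‖ ≤ finrank ℝ V * K ^ 2 := by
    have : ∀ i ∈ Finset.univ, ‖d i • e i‖ ≤ K ^ 2 := fun i _ => by
      have h1 : ‖d i‖ ≤ K * ‖e i‖ :=
        (norm_fst_le _).trans ((ContinuousLinearMap.le_opNorm _ _).trans
          (by gcongr; exact h.fderiv_map))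
      rw [norm_smul]
      calc ‖d i‖ * ‖e i‖ ≤ K * ‖e i‖ * ‖e i‖ := by gcongr
        _ = K * ‖e i‖ ^ 2 := by ring
        _ ≤ K * K := by gcongr; exact hen i
        _ = K ^ 2 := by ring
    simpa using norm_sum_le_of_le _ this
  have hn0 : (0 : ℝ) ≤ finrank ℝ V := by positivity
  have p1 : 0 ≤ finrank ℝ V * (K ^ 3 * ((K + 2 * K ^ 4) * K)) := by positivity
  have p2 : 0 ≤ finrank ℝ V * K ^ 3 := by positivity
  have p3 : 0 < K ^ 3 := by positivity
  -- The correction absorbs the `β'` term: `η` is chosen so that its `t`-component under `DX` is `∑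
  -- (d i)²`.
  refine ⟨e, ξ - (2⁻¹ * (b' / b)) • η, fun i => ?_, ?_, fun v => ?_, ?_⟩
  · have := hen i
    have : ‖e i‖ ≤ 1 + K := by nlinarith [sq_nonneg (‖e i‖ - 1)]
    unfold subsolutionConstant
    linarith
  · refine (norm_sub_le _ _).trans ?_
    rw [norm_smul, norm_mul, Real.norm_eq_abs (b' / b)]
    have h2 : ‖(2⁻¹ : ℝ)‖ * |b' / b| * ‖η‖ ≤ 1 * K * (finrank ℝ V * K ^ 2) := by
      gcongr
      norm_num
    unfold subsolutionConstant
    linarith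
  · refine (h.norm_sq_le_sum_inner hK he v).trans ?_
    refine mul_le_mul_of_nonneg_right ?_ (Finset.sum_nonneg fun i _ => sq_nonneg _)
    unfold subsolutionConstant
    linarith
  · set S := fun i => fderiv ℝ G (X y) (1, 0) (0, (fderiv ℝ X y (e i)).2)
      (0, (fderiv ℝ X y (e i)).2) with hS
    have h1 : ∀ i, 2 * (b * (covariantAcceleration G X y (e i)).1)
        = 2 * b * (fderiv ℝ (fderiv ℝ X) y (e i) (e i)).1 + b' * d i ^ 2 - S i := fun i => by
      have := christoffel_vertical hG hβ hsplit hpos (fderiv ℝ X y (e i))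
      simp only [covariantAcceleration, Prod.fst_add, mul_add, hS, hd]
      linarith
    have h2 : 2 * (b * (fderiv ℝ X y ξ).1) = ∑ i, (2 * b *
        (fderiv ℝ (fderiv ℝ X) y (e i) (e i)).1 + b' * d i ^ 2 - S i) := by
      rw [hξ, Prod.fst_sum, Finset.mul_sum, Finset.mul_sum]
      exact Finset.sum_congr rfl fun i _ => h1 i
    rw [Finset.sum_sub_distrib, Finset.sum_add_distrib, ← Finset.mul_sum,
      ← Finset.mul_sum] at h2
    have h3 : 0 ≤ σ * ∑ i, S i := by
      rw [Finset.mul_sum]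
      exact Finset.sum_nonneg fun i _ => hmono _
    have h4 : (fderiv ℝ X y η).1 = ∑ i, d i ^ 2 := by
      rw [hη, map_sum, Prod.fst_sum]
      exact Finset.sum_congr rfl fun i _ => by
        rw [map_smul, Prod.smul_fst, smul_eq_mul, pow_two]
    simp only [hD, hDD, map_sub, map_smul, Prod.fst_sub, Prod.smul_fst, smul_eq_mul, h4,
      ← Finset.mul_sum]
    set P := ∑ i, (fderiv ℝ (fderiv ℝ X) y (e i) (e i)).1
    set Q := ∑ i, d i ^ 2
    set x := (fderiv ℝ X y ξ).1
    have h5 : x - 2⁻¹ * (b' / b) * Q = P - (∑ i, S i) / (2 * b) := by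
      field_simp
      linarith
    rw [h5, mul_sub]
    have : 0 ≤ σ * ((∑ i, S i) / (2 * b)) := by
      rw [← mul_div_assoc]; positivity
    linarith

/-- The first component of a minimal submanifold of a monotone split metric is locally constant
near a local maximum (`σ = 1`) or minimum (`σ = -1`). -/
theorem eventually_fst_eq_of_isLocalMax [FiniteDimensional ℝ V] [FiniteDimensional ℝ E] {β : ℝ → ℝ}
    {G : ℝ × E → ℝ × E →L[ℝ] ℝ × E →L[ℝ] ℝ} {X : V → ℝ × E} {σ : ℝ} {p : V} (hσ : σ ≠ 0)
    (hX : ContDiffAt ℝ 2 X p) (hG : ContDiffAt ℝ 1 G (X p)) (hβ : ContDiffAt ℝ 1 β (X p).1)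
    (hβ0 : 0 < β (X p).1) (hpos : ∀ w, w ≠ 0 → 0 < G (X p) w w)
    (hinj : Function.Injective (fderiv ℝ X p))
    (hsplit : ∀ᶠ q in 𝓝 (X p), IsSplitAt β G q)
    (hsymm : ∀ᶠ q in 𝓝 (X p), ∀ a b, G q a b = G q b a)
    (hmono : ∀ᶠ q in 𝓝 (X p), ∀ w, 0 ≤ σ * fderiv ℝ G q (1, 0) (0, w) (0, w))
    (hH : ∀ᶠ y in 𝓝 p, LocalMeanCurvatureZero G X y)
    (hmax : IsLocalMax (fun y => σ * (X y).1) p) : ∀ᶠ y in 𝓝 p, (X y).1 = (X p).1 := by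
  obtain ⟨K, hK, hbound⟩ := eventually_geometryBound hG hX hpos hinj
  have hXc := hX.continuousAt
  have hX1 : ContinuousAt (fun y => (X y).1) p := continuous_fst.continuousAt.comp hXc
  have hβ' : ContinuousAt (deriv β) (X p).1 :=
    (ContinuousLinearMap.apply ℝ ℝ (1 : ℝ)).continuous.continuousAt.comp
      (hβ.fderiv_right (m := 0) (by simp)).continuousAt
  have hquot : ContinuousAt (fun y => deriv β (X y).1 / β (X y).1) p :=
    (hβ'.comp (f := fun y => (X y).1) hX1).div
      (hβ.continuousAt.comp (f := fun y => (X y).1) hX1) hβ0.ne'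
  obtain ⟨K', hK'⟩ := eventually_norm_le hquot
  have hC : ∀ n : ℕ, 0 < subsolutionConstant n (max K K') := fun n => by
    unfold subsolutionConstant
    have : 0 < max K K' := lt_max_of_lt_left hK
    positivity
  have hsub : ∀ᶠ y in 𝓝 p, IsSubsolutionAt (Fin (finrank ℝ V))
      (subsolutionConstant (finrank ℝ V) (max K K')) (fun y => σ * (X y).1) y := by
    filter_upwards [hbound, hK', hX.eventually (by simp), hXc.eventually (hG.eventually (by simp)),
      hX1.eventually (hβ.eventually (by simp)),
      (hβ.continuousAt.comp (f := fun y => (X y).1) hX1).eventually_const_lt hβ0,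
      hXc.eventually hsplit.eventually_nhds, hXc.eventually hsymm, hXc.eventually hmono, hH]
      with y y1 y2 y3 y4 y5 y6 y7 y8 y9 y10
    exact isSubsolutionAt_of_localMeanCurvatureZero (y1.mono hK (le_max_left _ _))
      (lt_max_of_lt_left hK) y3
      (y4.differentiableAt one_ne_zero) (y5.differentiableAt one_ne_zero) y6
      (y2.trans (le_max_right _ _)) y7 y8 y9 y10
  have hu : ContDiffAt ℝ 2 (fun y => σ * (X y).1) p := contDiffAt_const.mul hX.fst
  filter_upwards [eventually_eq_of_isLocalMax (hC _) hu hsub hmax] with y hy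
  exact mul_left_cancel₀ hσ hy

end SplitLocal

/-! ### Uniqueness of Christoffel vectors and normal parts -/

section Uniqueness

variable {W : Type*} [NormedAddCommGroup W] [NormedSpace ℝ W]

/-- `christoffel` and `normalPart` are arbitrary choices from their specifications, so comparing
them between the product and a slice requires uniqueness. -/
theorem eq_of_forall_bilin_eq {B : W →L[ℝ] W →L[ℝ] ℝ} (hB : ∀ v, v ≠ 0 → 0 < B v v) {c d : W}
    (h : ∀ z, B c z = B d z) : c = d := by
  by_contra hne
  have h1 := hB (c - d) (sub_ne_zero.2 hne)
  rw [map_sub B, sub_apply, h, sub_self] at h1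
  exact h1.false

theorem IsChristoffelVector.unique {G : W → W →L[ℝ] W →L[ℝ] ℝ} {y a b c d : W}
    (hG : ∀ v, v ≠ 0 → 0 < G y v v) (hc : IsChristoffelVector G y a b c)
    (hd : IsChristoffelVector G y a b d) : c = d :=
  eq_of_forall_bilin_eq hG fun z => by linarith [hc z, hd z]

theorem IsNormalPart.unique {B : W →L[ℝ] W →L[ℝ] ℝ} (hB : ∀ v, v ≠ 0 → 0 < B v v)
    {T : Submodule ℝ W} {v w w' : W} (hw : IsNormalPart B T v w) (hw' : IsNormalPart B T v w') :
    w = w' := by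
  by_contra hne
  have hT : w - w' ∈ T := by
    have := T.sub_mem hw'.1 hw.1
    rwa [sub_sub_sub_cancel_left] at this
  have h1 := hB (w - w') (sub_ne_zero.2 hne)
  have h2 : B (w - w') (w - w') = B w (w - w') - B w' (w - w') := by rw [map_sub B, sub_apply]
  rw [h2, hw.2 _ hT, hw'.2 _ hT, sub_self] at h1
  exact h1.false

end Uniqueness

/-! ### Restriction to a slice `t = const` -/

section Slice

variable {V E : Type*} [NormedAddCommGroup V] [NormedSpace ℝ V]
  [NormedAddCommGroup E] [NormedSpace ℝ E]

theorem fderiv_slice {Y : V → E} {y : V} (t : ℝ) (hY : ContDiffAt ℝ 2 Y y) :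
    (∀ v, fderiv ℝ (fun z => (t, Y z)) y v = (0, fderiv ℝ Y y v)) ∧
    ∀ v w, fderiv ℝ (fderiv ℝ (fun z => (t, Y z))) y v w
      = (0, fderiv ℝ (fderiv ℝ Y) y v w) := by
  have h1 : fderiv ℝ (fun z => (t, Y z)) =ᶠ[𝓝 y]
      fun z => ContinuousLinearMap.compL ℝ V E (ℝ × E) (.inr ℝ ℝ E) (fderiv ℝ Y z) := by
    filter_upwards [hY.eventually (by simp)] with z hz
    rw [((hasFDerivAt_const t z).prodMk (hz.differentiableAt two_ne_zero).hasFDerivAt).fderiv]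
    rfl
  refine ⟨fun v => by rw [h1.self_of_nhds]; rfl, fun v w => ?_⟩
  have h2 : DifferentiableAt ℝ (fderiv ℝ Y) y :=
    (hY.fderiv_right (m := 1) le_rfl).differentiableAt one_ne_zero
  have h3 : HasFDerivAt
      (fun z => ContinuousLinearMap.compL ℝ V E (ℝ × E) (.inr ℝ ℝ E) (fderiv ℝ Y z)) _ y :=
    (ContinuousLinearMap.compL ℝ V E (ℝ × E) (.inr ℝ ℝ E)).hasFDerivAt.comp y h2.hasFDerivAt
  rw [h1.fderiv_eq, h3.fderiv]
  rfl

variable {β : ℝ → ℝ} {G : ℝ × E → ℝ × E →L[ℝ] ℝ × E →L[ℝ] ℝ}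
  {G' : E → E →L[ℝ] E →L[ℝ] ℝ} {t : ℝ}

theorem fderiv_slice_metric {y : E} (hG : DifferentiableAt ℝ G (t, y))
    (hG' : DifferentiableAt ℝ G' y)
    (hslice : ∀ᶠ z in 𝓝 y, ∀ v w, G (t, z) (0, v) (0, w) = G' z v w) (a b c : E) :
    fderiv ℝ G (t, y) (0, a) (0, b) (0, c) = fderiv ℝ G' y a b c := by
  rw [← fderiv_bilinear_apply hG, ← fderiv_bilinear_apply hG']
  have h1 : (fun z => G' z b c) =ᶠ[𝓝 y] fun z => G (t, z) (0, b) (0, c) :=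
    hslice.mono fun z hz => (hz b c).symm
  have h2 : DifferentiableAt ℝ (fun q => G q (0, b) (0, c)) (t, y) := by fun_prop
  have h3 : HasFDerivAt (fun z => G (t, z) (0, b) (0, c)) _ y :=
    h2.hasFDerivAt.comp y ((hasFDerivAt_const t y).prodMk (hasFDerivAt_id y))
  rw [h1.fderiv_eq, h3.fderiv]
  rfl

theorem fderiv_vertical_eq_deriv {q : ℝ × E} (hG : DifferentiableAt ℝ G q) (a b : ℝ × E) :
    fderiv ℝ G q (1, 0) a b = deriv (fun s => G (s, q.2) a b) q.1 := by
  rw [← fderiv_bilinear_apply hG]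
  have h2 : DifferentiableAt ℝ (fun q => G q a b) (q.1, q.2) := by fun_prop
  have h3 : HasDerivAt (fun s : ℝ => G (s, q.2) a b) _ q.1 :=
    HasFDerivAt.comp_hasDerivAt (l := fun q => G q a b) q.1 h2.hasFDerivAt
      ((hasDerivAt_id q.1).prodMk (hasDerivAt_const q.1 q.2))
  exact h3.deriv.symm

theorem IsSplitAt.apply_horizontal {y : E} (hsplit : IsSplitAt β G (t, y))
    (hslice : ∀ v w, G (t, y) (0, v) (0, w) = G' y v w) (a : ℝ × E) (w : E) :
    G (t, y) a (0, w) = G' y a.2 w := by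
  rw [hsplit a (0, w), hslice]
  simp

/-- Koszul in the product, tested on horizontal vectors, is Koszul in the slice: the pairing with
`(0, z)` ignores the `t`-component. -/
theorem christoffel_slice [FiniteDimensional ℝ E] {y : E} (hG : DifferentiableAt ℝ G (t, y))
    (hG' : DifferentiableAt ℝ G' y) (hsplit : IsSplitAt β G (t, y))
    (hpos : ∀ v, v ≠ 0 → 0 < G (t, y) v v)
    (hslice : ∀ᶠ z in 𝓝 y, ∀ v w, G (t, z) (0, v) (0, w) = G' z v w)
    (hpos' : ∀ v, v ≠ 0 → 0 < G' y v v) (a b : E) :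
    (christoffel G (t, y) (0, a) (0, b)).2 = christoffel G' y a b := by
  refine IsChristoffelVector.unique hpos' (fun z => ?_) (christoffel_spec G' y a b hpos')
  have h := christoffel_spec G (t, y) (0, a) (0, b) hpos (0, z)
  rw [hsplit.apply_horizontal hslice.self_of_nhds] at h
  simpa only [fderiv_slice_metric hG hG' hslice] using h

/-- A minimal submanifold of a split metric that lies in a slice `t = const` is minimal in the
slice. -/
theorem localMeanCurvatureZero_of_slice [FiniteDimensional ℝ E] {Y : V → E} {y : V} (hY : ContDiffAt ℝ 2 Y y)
    (hG : DifferentiableAt ℝ G (t, Y y)) (hG' : DifferentiableAt ℝ G' (Y y))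
    (hsplit : IsSplitAt β G (t, Y y)) (hpos : ∀ v, v ≠ 0 → 0 < G (t, Y y) v v)
    (hslice : ∀ᶠ z in 𝓝 (Y y), ∀ v w, G (t, z) (0, v) (0, w) = G' z v w)
    (hH : LocalMeanCurvatureZero G (fun z => (t, Y z)) y) : LocalMeanCurvatureZero G' Y y := by
  intro e he
  obtain ⟨hD, hDD⟩ := fderiv_slice t hY
  have hsl := hslice.self_of_nhds
  have hpos' : ∀ v, v ≠ 0 → 0 < G' (Y y) v v := fun v hv => by
    rw [← hsl]
    exact hpos _ fun h => hv (congrArg Prod.snd h)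
  have key : ∀ v, localSecondFundamentalForm G' Y y v v
      = (localSecondFundamentalForm G (fun z => (t, Y z)) y v v).2 := fun v => by
    simp only [localSecondFundamentalForm]
    -- The second component of the ambient normal part is shown to satisfy the specification of the
    -- normal part in the slice; this works because the tangent space is horizontal.
    refine IsNormalPart.unique hpos' (normalPart_spec _ hpos' _ _) ?_
    obtain ⟨⟨u, hu⟩, hn⟩ := normalPart_spec _ hpos
      (LinearMap.range (fderiv ℝ (fun z => (t, Y z)) y).toLinearMap)
      (fderiv ℝ (fderiv ℝ (fun z => (t, Y z))) y v v + christoffel G (t, Y y)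
        (fderiv ℝ (fun z => (t, Y z)) y v) (fderiv ℝ (fun z => (t, Y z)) y v))
    constructor
    · refine ⟨u, ?_⟩
      have h2 := congrArg Prod.snd hu
      rw [ContinuousLinearMap.coe_coe, hD] at h2
      change fderiv ℝ Y y u = _ at h2
      rw [ContinuousLinearMap.coe_coe, h2, Prod.snd_sub, Prod.snd_add, hDD, hD,
        christoffel_slice hG hG' hsplit hpos hslice hpos']
    · rintro _ ⟨u, rfl⟩
      have h2 := hn (fderiv ℝ (fun z => (t, Y z)) y u) ⟨u, rfl⟩
      rw [hD u, hsplit.apply_horizontal hsl] at h2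
      exact h2
  have h := hH e fun i j => by
    rw [hD, hD, hsl]
    exact he i j
  simp only [key]
  rw [← Prod.snd_sum, h, Prod.snd_zero]

end Slice

/-! ### Smoothness and injectivity of chart representations -/

section Charts

variable {E H M E' H' M' : Type*}
  [NormedAddCommGroup E] [NormedSpace ℝ E] [TopologicalSpace H]
  [TopologicalSpace M] [ChartedSpace H M]
  [NormedAddCommGroup E'] [NormedSpace ℝ E'] [TopologicalSpace H']
  [TopologicalSpace M'] [ChartedSpace H' M']
  {J : ModelWithCorners ℝ E H} {J' : ModelWithCorners ℝ E' H'}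

theorem injective_mfderiv_of_eventually_leftInverse {f : M → M'} {h : M' → M} {x : M}
    (hf : MDifferentiableAt J J' f x) (hh : MDifferentiableAt J' J h (f x))
    (hid : h ∘ f =ᶠ[𝓝 x] id) : Function.Injective (mfderiv J J' f x) := by
  have h1 : mfderiv J J (h ∘ f) x = mfderiv J J id x := hid.mfderiv_eq
  rw [mfderiv_comp x hh hf, mfderiv_id] at h1
  intro a b hab
  have h2 := congrArg (fun L => L a) h1
  have h3 := congrArg (fun L => L b) h1
  simp only [ContinuousLinearMap.comp_apply] at h2 h3
  rw [hab] at h2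
  exact h2.symm.trans h3

variable {c : OpenPartialHomeomorph M H}

theorem contMDiffOn_extend_symm_target (hc : c ∈ IsManifold.maximalAtlas J ∞ M) :
    ContMDiffOn 𝓘(ℝ, E) J ∞ (c.extend J).symm (c.extend J).target := by
  rw [OpenPartialHomeomorph.extend_target']
  exact contMDiffOn_extend_symm hc

theorem contMDiffAt_extend_symm [J.Boundaryless] (hc : c ∈ IsManifold.maximalAtlas J ∞ M) {y : E}
    (hy : y ∈ (c.extend J).target) : ContMDiffAt 𝓘(ℝ, E) J ∞ (c.extend J).symm y :=
  (contMDiffOn_extend_symm_target hc).contMDiffAt (c.isOpen_extend_target.mem_nhds hy)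

theorem injective_mfderiv_extend_symm [J.Boundaryless] (hc : c ∈ IsManifold.maximalAtlas J ∞ M) {y : E}
    (hy : y ∈ (c.extend J).target) :
    Function.Injective (mfderiv 𝓘(ℝ, E) J (c.extend J).symm y) := by
  refine injective_mfderiv_of_eventually_leftInverse (h := c.extend J)
    ((contMDiffAt_extend_symm hc hy).mdifferentiableAt (by simp))
    ((c.contMDiffAt_extend hc (c.extend_source (I := J) ▸ (c.extend J).map_target hy)).mdifferentiableAt (by simp)) ?_
  filter_upwards [c.isOpen_extend_target.mem_nhds hy] with z hz using (c.extend J).right_inv hz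

theorem injective_mfderiv_extend [J.Boundaryless] (hc : c ∈ IsManifold.maximalAtlas J ∞ M) {p : M}
    (hp : p ∈ c.source) : Function.Injective (mfderiv J 𝓘(ℝ, E) (c.extend J) p) := by
  have hp' : p ∈ (c.extend J).source := by rwa [c.extend_source]
  refine injective_mfderiv_of_eventually_leftInverse (h := (c.extend J).symm)
    ((c.contMDiffAt_extend hc hp).mdifferentiableAt (by simp))
    ((contMDiffAt_extend_symm hc ((c.extend J).map_source hp')).mdifferentiableAt (by simp)) ?_
  filter_upwards [c.open_source.mem_nhds hp] with z hz
  exact (c.extend J).left_inv (by rwa [c.extend_source])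

variable [J.Boundaryless] {c' : OpenPartialHomeomorph M' H'}

theorem contDiffAt_chart_representation (hc : c ∈ IsManifold.maximalAtlas J ∞ M)
    (hc' : c' ∈ IsManifold.maximalAtlas J' ∞ M') {x : M → M'} (hx : ContMDiff J J' ∞ x) {y : E}
    (hy : y ∈ (c.extend J).target) (hxy : x ((c.extend J).symm y) ∈ c'.source) :
    ContDiffAt ℝ ∞ (c'.extend J' ∘ x ∘ (c.extend J).symm) y :=
  contMDiffAt_iff_contDiffAt.1 <| ContMDiffAt.comp y (c'.contMDiffAt_extend hc' hxy)
    (ContMDiffAt.comp y hx.contMDiffAt (contMDiffAt_extend_symm hc hy))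

theorem injective_fderiv_chart_representation [J'.Boundaryless] (hc : c ∈ IsManifold.maximalAtlas J ∞ M)
    (hc' : c' ∈ IsManifold.maximalAtlas J' ∞ M') {x : M → M'} (hx : ContMDiff J J' ∞ x)
    (hinj : ∀ p, Function.Injective (mfderiv J J' x p)) {y : E}
    (hy : y ∈ (c.extend J).target) (hxy : x ((c.extend J).symm y) ∈ c'.source) :
    Function.Injective (fderiv ℝ (c'.extend J' ∘ x ∘ (c.extend J).symm) y) := by
  have h1 := (contMDiffAt_extend_symm hc hy).mdifferentiableAt (by simp)
  have h2 : MDifferentiableAt J J' x ((c.extend J).symm y) :=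
    hx.mdifferentiableAt (by simp)
  have h3 := (c'.contMDiffAt_extend hc' hxy).mdifferentiableAt (by simp)
  rw [← mfderiv_eq_fderiv, mfderiv_comp y (g := c'.extend J') h3 (h2.comp y h1),
    mfderiv_comp y h2 h1]
  exact (injective_mfderiv_extend hc' hxy).comp
    ((hinj _).comp (injective_mfderiv_extend_symm hc hy))

end Charts

/-! ### The metrics in charts of `F` and in product charts -/

section ChartMetric

variable {k : ℕ} {F : Type*} [TopologicalSpace F] [ChartedSpace (EuclideanSpace ℝ (Fin k)) F]
  {I : Set ℝ} {β : ℝ → ℝ}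
  {g : ℝ → (p : F) → TangentSpace (𝓡 k) p →L[ℝ] TangentSpace (𝓡 k) p →L[ℝ] ℝ}
  {ψ : OpenPartialHomeomorph F (EuclideanSpace ℝ (Fin k))}

/-- The coordinate field of `a` is a smooth field of tangent vectors; the metric is evaluated on two
such fields to obtain its smooth components. -/
theorem contMDiffOn_mfderiv_extend_symm [IsManifold (𝓡 k) ∞ F] (hψ : ψ ∈ IsManifold.maximalAtlas (𝓡 k) ∞ F)
    (a : EuclideanSpace ℝ (Fin k)) :
    ContMDiffOn 𝓘(ℝ, EuclideanSpace ℝ (Fin k)) (𝓡 k).tangent ∞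
      (fun y => (⟨(ψ.extend (𝓡 k)).symm y,
        mfderiv 𝓘(ℝ, EuclideanSpace ℝ (Fin k)) (𝓡 k) (ψ.extend (𝓡 k)).symm y a⟩ :
          TangentBundle (𝓡 k) F)) (ψ.extend (𝓡 k)).target := by
  have hopen : IsOpen (ψ.extend (𝓡 k)).target := ψ.isOpen_extend_target
  have : IsManifold (𝓡 k) 1 F := IsManifold.of_le (n := ∞) (by simp)
  have h1 := (contMDiffOn_extend_symm_target hψ).contMDiffOn_tangentMapWithin (m := ∞)
    (by simp) hopen.uniqueMDiffOn
  have h2 : ContMDiffOn 𝓘(ℝ, EuclideanSpace ℝ (Fin k))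
      (𝓘(ℝ, EuclideanSpace ℝ (Fin k))).tangent ∞
      (fun y => (⟨y, a⟩ : TangentBundle 𝓘(ℝ, EuclideanSpace ℝ (Fin k))
        (EuclideanSpace ℝ (Fin k)))) (ψ.extend (𝓡 k)).target :=
    contMDiffOn_vectorSpace_iff_contDiffOn.2 contDiffOn_const
  refine (h1.comp h2 fun y hy => hy).congr fun y hy => ?_
  simp only [Function.comp_apply, tangentMapWithin, mfderivWithin_of_isOpen hopen hy]

theorem contDiffOn_chartMetric [IsManifold (𝓡 k) ∞ F] (hg : IsRiemannianMetricFamily I g)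
    (hψ : ψ ∈ IsManifold.maximalAtlas (𝓡 k) ∞ F) :
    ContDiffOn ℝ ∞ (fun q : ℝ × EuclideanSpace ℝ (Fin k) => chartMetric (𝓡 k) (g q.1) ψ q.2)
      (I ×ˢ (ψ.extend (𝓡 k)).target) := by
  rw [contDiffOn_clm_apply]
  intro a
  rw [contDiffOn_clm_apply]
  intro b q hq
  rw [← contMDiffWithinAt_iff_contDiffWithinAt]
  have hsnd : ContMDiffOn 𝓘(ℝ, ℝ × EuclideanSpace ℝ (Fin k)) 𝓘(ℝ, EuclideanSpace ℝ (Fin k)) ∞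
      Prod.snd (I ×ˢ (ψ.extend (𝓡 k)).target) := contDiff_snd.contMDiff.contMDiffOn
  have hfst : ContMDiffOn 𝓘(ℝ, ℝ × EuclideanSpace ℝ (Fin k)) 𝓘(ℝ, ℝ) ∞
      Prod.fst (I ×ˢ (ψ.extend (𝓡 k)).target) := contDiff_fst.contMDiff.contMDiffOn
  have hmaps : Set.MapsTo Prod.snd (I ×ˢ (ψ.extend (𝓡 k)).target) (ψ.extend (𝓡 k)).target :=
    fun q hq => hq.2
  have hs := (contMDiffOn_extend_symm_target hψ).comp hsnd hmaps
  have hG := hg.contMDiffOn.comp (hfst.prodMk hs) (fun q hq => ⟨hq.1, Set.mem_univ _⟩)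
  have ha := (contMDiffOn_mfderiv_extend_symm hψ a).comp hsnd hmaps
  have hb := (contMDiffOn_mfderiv_extend_symm hψ b).comp hsnd hmaps
  -- The metric applied to coordinate fields is first a map to the trivial line bundle over `F`; its
  -- fibre component is the wanted real function.
  have : ContMDiffWithinAt 𝓘(ℝ, ℝ × EuclideanSpace ℝ (Fin k)) ((𝓡 k).prod 𝓘(ℝ, ℝ)) ∞
      (fun q : ℝ × EuclideanSpace ℝ (Fin k) => TotalSpace.mk' ℝ (E := Bundle.Trivial F ℝ)
        ((ψ.extend (𝓡 k)).symm q.2) (chartMetric (𝓡 k) (g q.1) ψ q.2 a b))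
      (I ×ˢ (ψ.extend (𝓡 k)).target) q := by
    apply ContMDiffWithinAt.clm_bundle_apply₂ (F₁ := EuclideanSpace ℝ (Fin k))
      (F₂ := EuclideanSpace ℝ (Fin k))
    · exact hG q hq
    · exact ha q hq
    · exact hb q hq
  simp only [contMDiffWithinAt_totalSpace] at this
  exact this.2

theorem chartMetric_symm [IsManifold (𝓡 k) ∞ F] (hg : IsRiemannianMetricFamily I g) {t : ℝ} (ht : t ∈ I)
    (y v w : EuclideanSpace ℝ (Fin k)) :
    chartMetric (𝓡 k) (g t) ψ y v w = chartMetric (𝓡 k) (g t) ψ y w v :=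
  hg.symm t ht _ _ _

theorem chartMetric_pos [IsManifold (𝓡 k) ∞ F] (hg : IsRiemannianMetricFamily I g)
    (hψ : ψ ∈ IsManifold.maximalAtlas (𝓡 k) ∞ F) {t : ℝ} (ht : t ∈ I)
    {y : EuclideanSpace ℝ (Fin k)} (hy : y ∈ (ψ.extend (𝓡 k)).target)
    {v : EuclideanSpace ℝ (Fin k)} (hv : v ≠ 0) : 0 < chartMetric (𝓡 k) (g t) ψ y v v := by
  exact hg.pos t ht _ _ fun h => hv (injective_mfderiv_extend_symm hψ hy
    (h.trans (ContinuousLinearMap.map_zero _).symm))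

/-- The product of the identity of `ℝ` and a chart of `F`. -/
def productChart (ψ : OpenPartialHomeomorph F (EuclideanSpace ℝ (Fin k))) :
    OpenPartialHomeomorph (ℝ × F) (ModelProd ℝ (EuclideanSpace ℝ (Fin k))) :=
  (OpenPartialHomeomorph.refl ℝ).prod ψ

theorem productChart_mem_maximalAtlas [IsManifold (𝓡 k) ∞ F] (hψ : ψ ∈ IsManifold.maximalAtlas (𝓡 k) ∞ F) :
    productChart ψ ∈ IsManifold.maximalAtlas (𝓘(ℝ, ℝ).prod (𝓡 k)) ∞ (ℝ × F) :=
  IsManifold.mem_maximalAtlas_prod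
    (StructureGroupoid.id_mem_maximalAtlas (contDiffGroupoid ∞ 𝓘(ℝ, ℝ))) hψ

theorem chartMetric_splitMetric (hψ : ψ ∈ IsManifold.maximalAtlas (𝓡 k) ∞ F)
    {q : ℝ × EuclideanSpace ℝ (Fin k)} (hq : q.2 ∈ (ψ.extend (𝓡 k)).target)
    (a b : ℝ × EuclideanSpace ℝ (Fin k)) :
    chartMetric (𝓘(ℝ, ℝ).prod (𝓡 k)) (splitMetric β g) (productChart ψ) q a b
      = β q.1 * (a.1 * b.1) + chartMetric (𝓡 k) (g q.1) ψ q.2 a.2 b.2 := by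
  have h1 : HasMFDerivAt 𝓘(ℝ, ℝ × EuclideanSpace ℝ (Fin k)) 𝓘(ℝ, ℝ) Prod.fst q
      (ContinuousLinearMap.fst ℝ ℝ (EuclideanSpace ℝ (Fin k))) :=
    hasFDerivAt_fst.hasMFDerivAt
  have h2 : HasMFDerivAt 𝓘(ℝ, ℝ × EuclideanSpace ℝ (Fin k)) 𝓘(ℝ, EuclideanSpace ℝ (Fin k))
      Prod.snd q (ContinuousLinearMap.snd ℝ ℝ (EuclideanSpace ℝ (Fin k))) :=
    hasFDerivAt_snd.hasMFDerivAt
  have h3 := ((contMDiffAt_extend_symm hψ hq).mdifferentiableAt (by simp)).hasMFDerivAt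
  have h4 := (h1.prodMk (h3.comp q h2)).mfderiv
  have h5 : mfderiv 𝓘(ℝ, ℝ × EuclideanSpace ℝ (Fin k)) (𝓘(ℝ, ℝ).prod (𝓡 k))
      ((productChart ψ).extend (𝓘(ℝ, ℝ).prod (𝓡 k))).symm q = _ := h4
  unfold chartMetric
  erw [h5]
  rfl

end ChartMetric

/-! ### Minimal submanifolds of `β dt² + g_t` -/

section Minimal

variable {n k : ℕ}

theorem eventually_mem_domain {F : Type*} [TopologicalSpace F] {I : Set ℝ}
    {ψ : OpenPartialHomeomorph F (EuclideanSpace ℝ (Fin k))}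
    (hI : IsOpen I) {q : ℝ × EuclideanSpace ℝ (Fin k)} (hqI : q.1 ∈ I)
    (hq : q.2 ∈ (ψ.extend (𝓡 k)).target) :
    ∀ᶠ q' in 𝓝 q, q'.1 ∈ I ∧ q'.2 ∈ (ψ.extend (𝓡 k)).target :=
  (hI.prod ψ.isOpen_extend_target).mem_nhds ⟨hqI, hq⟩
variable {F : Type*} [TopologicalSpace F]
  [ChartedSpace (EuclideanSpace ℝ (Fin k)) F] {I : Set ℝ} {β : ℝ → ℝ}
  {g : ℝ → (p : F) → TangentSpace (𝓡 k) p →L[ℝ] TangentSpace (𝓡 k) p →L[ℝ] ℝ}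
  {ψ : OpenPartialHomeomorph F (EuclideanSpace ℝ (Fin k))}

/-- The components of `β dt² + g_t` in the product chart of `ψ`. -/
def splitChartMetric (β : ℝ → ℝ)
    (g : ℝ → (p : F) → TangentSpace (𝓡 k) p →L[ℝ] TangentSpace (𝓡 k) p →L[ℝ] ℝ)
    (ψ : OpenPartialHomeomorph F (EuclideanSpace ℝ (Fin k))) :
    ℝ × EuclideanSpace ℝ (Fin k) →
      ℝ × EuclideanSpace ℝ (Fin k) →L[ℝ] ℝ × EuclideanSpace ℝ (Fin k) →L[ℝ] ℝ :=
  chartMetric (𝓘(ℝ, ℝ).prod (𝓡 k)) (splitMetric β g) (productChart ψ)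

theorem splitChartMetric_apply (hψ : ψ ∈ IsManifold.maximalAtlas (𝓡 k) ∞ F)
    {q : ℝ × EuclideanSpace ℝ (Fin k)} (hq : q.2 ∈ (ψ.extend (𝓡 k)).target)
    (a b : ℝ × EuclideanSpace ℝ (Fin k)) :
    splitChartMetric β g ψ q a b
      = β q.1 * (a.1 * b.1) + chartMetric (𝓡 k) (g q.1) ψ q.2 a.2 b.2 :=
  chartMetric_splitMetric hψ hq a b

theorem splitChartMetric_horizontal (hψ : ψ ∈ IsManifold.maximalAtlas (𝓡 k) ∞ F)
    {q : ℝ × EuclideanSpace ℝ (Fin k)} (hq : q.2 ∈ (ψ.extend (𝓡 k)).target)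
    (v w : EuclideanSpace ℝ (Fin k)) :
    splitChartMetric β g ψ q (0, v) (0, w) = chartMetric (𝓡 k) (g q.1) ψ q.2 v w := by
  rw [splitChartMetric_apply hψ hq]
  simp

theorem isSplitAt_splitChartMetric (hψ : ψ ∈ IsManifold.maximalAtlas (𝓡 k) ∞ F)
    {q : ℝ × EuclideanSpace ℝ (Fin k)} (hq : q.2 ∈ (ψ.extend (𝓡 k)).target) :
    IsSplitAt β (splitChartMetric β g ψ) q := fun a b => by
  rw [splitChartMetric_horizontal hψ hq, splitChartMetric_apply hψ hq]

variable [IsManifold (𝓡 k) ∞ F]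

theorem contDiffAt_splitChartMetric (hI : IsOpen I) (hβ : ContDiffOn ℝ ∞ β I)
    (hg : IsRiemannianMetricFamily I g) (hψ : ψ ∈ IsManifold.maximalAtlas (𝓡 k) ∞ F)
    {q : ℝ × EuclideanSpace ℝ (Fin k)} (hqI : q.1 ∈ I) (hq : q.2 ∈ (ψ.extend (𝓡 k)).target) :
    ContDiffAt ℝ ∞ (splitChartMetric β g ψ) q := by
  suffices h : ContDiffOn ℝ ∞ (splitChartMetric β g ψ) (I ×ˢ (ψ.extend (𝓡 k)).target) from
    h.contDiffAt (eventually_mem_domain hI hqI hq)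
  rw [contDiffOn_clm_apply]
  intro a
  rw [contDiffOn_clm_apply]
  intro b
  have h1 : ContDiffOn ℝ ∞ (fun q : ℝ × EuclideanSpace ℝ (Fin k) => β q.1)
      (I ×ˢ (ψ.extend (𝓡 k)).target) :=
    hβ.comp contDiff_fst.contDiffOn fun q hq => hq.1
  have h2 := ((contDiffOn_chartMetric hg hψ).clm_apply
    (contDiffOn_const (c := a.2))).clm_apply (contDiffOn_const (c := b.2))
  exact ((h1.mul contDiffOn_const).add h2).congr fun q hq => splitChartMetric_apply hψ hq.2 a b

theorem contDiffAt_chartMetric (hI : IsOpen I) (hg : IsRiemannianMetricFamily I g)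
    (hψ : ψ ∈ IsManifold.maximalAtlas (𝓡 k) ∞ F) {t : ℝ} (ht : t ∈ I)
    {y : EuclideanSpace ℝ (Fin k)} (hy : y ∈ (ψ.extend (𝓡 k)).target) :
    ContDiffAt ℝ ∞ (chartMetric (𝓡 k) (g t) ψ) y :=
  ((contDiffOn_chartMetric hg hψ).contDiffAt
    (eventually_mem_domain (q := (t, y)) hI ht hy)).comp y (contDiffAt_const.prodMk contDiffAt_id)

theorem splitChartMetric_pos (hβ : ∀ t ∈ I, 0 < β t) (hg : IsRiemannianMetricFamily I g)
    (hψ : ψ ∈ IsManifold.maximalAtlas (𝓡 k) ∞ F) {q : ℝ × EuclideanSpace ℝ (Fin k)}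
    (hqI : q.1 ∈ I) (hq : q.2 ∈ (ψ.extend (𝓡 k)).target) {v : ℝ × EuclideanSpace ℝ (Fin k)}
    (hv : v ≠ 0) : 0 < splitChartMetric β g ψ q v v := by
  rw [splitChartMetric_apply hψ hq]
  have h0 := hβ _ hqI
  rcases eq_or_ne v.2 0 with h | h
  · have h1 : v.1 ≠ 0 := fun h1 => hv (Prod.ext h1 h)
    have h2 : 0 < v.1 * v.1 := mul_self_pos.2 h1
    rw [h]
    simp only [map_zero, add_zero]
    positivity
  · have h1 := chartMetric_pos hg hψ hqI hq h
    have h2 := mul_self_nonneg v.1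
    positivity

theorem splitChartMetric_symm (hg : IsRiemannianMetricFamily I g)
    (hψ : ψ ∈ IsManifold.maximalAtlas (𝓡 k) ∞ F) {q : ℝ × EuclideanSpace ℝ (Fin k)}
    (hqI : q.1 ∈ I) (hq : q.2 ∈ (ψ.extend (𝓡 k)).target) (v w : ℝ × EuclideanSpace ℝ (Fin k)) :
    splitChartMetric β g ψ q v w = splitChartMetric β g ψ q w v := by
  rw [splitChartMetric_apply hψ hq, splitChartMetric_apply hψ hq, chartMetric_symm hg hqI,
    mul_comm v.1]

/-- Carries the sign of `∂_t g` over to the coordinate metric: the differential of the chart does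
not depend on `t`, so the right-hand side is `∂_t g` on a fixed tangent vector. -/
theorem fderiv_splitChartMetric_vertical (hI : IsOpen I) (hβ : ContDiffOn ℝ ∞ β I)
    (hg : IsRiemannianMetricFamily I g) (hψ : ψ ∈ IsManifold.maximalAtlas (𝓡 k) ∞ F)
    {q : ℝ × EuclideanSpace ℝ (Fin k)} (hqI : q.1 ∈ I) (hq : q.2 ∈ (ψ.extend (𝓡 k)).target)
    (w : EuclideanSpace ℝ (Fin k)) :
    fderiv ℝ (splitChartMetric β g ψ) q (1, 0) (0, w) (0, w)
      = deriv (fun s => chartMetric (𝓡 k) (g s) ψ q.2 w w) q.1 := by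
  have hG : DifferentiableAt ℝ (splitChartMetric β g ψ) q :=
    (contDiffAt_splitChartMetric hI hβ hg hψ hqI hq).differentiableAt (by simp)
  have hf : (fun s => splitChartMetric β g ψ (s, q.2) (0, w) (0, w))
      = fun s => chartMetric (𝓡 k) (g s) ψ q.2 w w :=
    funext fun s => splitChartMetric_horizontal (q := (s, q.2)) hψ hq w w
  rw [fderiv_vertical_eq_deriv hG, hf]

variable {S : Type*} [TopologicalSpace S] [ChartedSpace (EuclideanSpace ℝ (Fin n)) S]
  {x : S → ℝ × F}

/-- For a minimal submanifold of a monotone split metric, the first component is constant near a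
local maximum (`σ > 0`) or a local minimum (`σ < 0`). -/
theorem IsMinimalSubmanifold.eventually_fst_eq [IsManifold (𝓡 n) ∞ S] (hI : IsOpen I) (hβ : ContDiffOn ℝ ∞ β I)
    (hβ0 : ∀ t ∈ I, 0 < β t) (hg : IsRiemannianMetricFamily I g) {σ : ℝ} (hσ : σ ≠ 0)
    (hmono : ∀ t ∈ I, ∀ (p : F) (v : TangentSpace (𝓡 k) p),
      0 ≤ σ * deriv (fun s => g s p v v) t)
    (hx : IsMinimalSubmanifold (𝓡 n) (𝓘(ℝ, ℝ).prod (𝓡 k)) (splitMetric β g) x) {p : S}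
    (hp : (x p).1 ∈ I) (hmax : IsLocalMax (fun p => σ * (x p).1) p) :
    ∀ᶠ p' in 𝓝 p, (x p').1 = (x p).1 := by
  set φ := chartAt (EuclideanSpace ℝ (Fin n)) p with hφdef
  set ψ := chartAt (EuclideanSpace ℝ (Fin k)) (x p).2
  have hφ : φ ∈ IsManifold.maximalAtlas (𝓡 n) ∞ S := IsManifold.chart_mem_maximalAtlas p
  have hψ : ψ ∈ IsManifold.maximalAtlas (𝓡 k) ∞ F := IsManifold.chart_mem_maximalAtlas (x p).2
  have hψ' := productChart_mem_maximalAtlas hψ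
  have hpφ : p ∈ φ.source := mem_chart_source _ p
  have hpφ' : p ∈ (φ.extend (𝓡 n)).source := by rwa [φ.extend_source]
  set y₀ := φ.extend (𝓡 n) p with hy₀
  have hy₀t : y₀ ∈ (φ.extend (𝓡 n)).target := (φ.extend (𝓡 n)).map_source hpφ'
  have hsymm₀ : (φ.extend (𝓡 n)).symm y₀ = p := (φ.extend (𝓡 n)).left_inv hpφ'
  have hpψ : x p ∈ (productChart ψ).source :=
    ⟨Set.mem_univ _, mem_chart_source (EuclideanSpace ℝ (Fin k)) (x p).2⟩
  have hxp : x ((φ.extend (𝓡 n)).symm y₀) ∈ (productChart ψ).source := by rwa [hsymm₀]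
  set X := (productChart ψ).extend (𝓘(ℝ, ℝ).prod (𝓡 k)) ∘ x ∘ (φ.extend (𝓡 n)).symm with hXdef
  have hXfst : ∀ y, (X y).1 = (x ((φ.extend (𝓡 n)).symm y)).1 := fun _ => rfl
  have hX₀I : (X y₀).1 ∈ I := by rw [hXfst, hsymm₀]; exact hp
  have hX₀t : (X y₀).2 ∈ (ψ.extend (𝓡 k)).target := by
    refine (ψ.extend (𝓡 k)).map_source ?_
    rw [ψ.extend_source]
    exact hxp.2
  have hcont : ContinuousAt (φ.extend (𝓡 n)).symm y₀ :=
    (contMDiffAt_extend_symm hφ hy₀t).continuousAt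
  have hev := eventually_mem_domain hI hX₀I hX₀t
  have hH : ∀ᶠ y in 𝓝 y₀, LocalMeanCurvatureZero (splitChartMetric β g ψ) X y := by
    have h1 : ContinuousAt (x ∘ (φ.extend (𝓡 n)).symm) y₀ :=
      hx.contMDiff.continuous.continuousAt.comp hcont
    filter_upwards [φ.isOpen_extend_target.mem_nhds hy₀t,
      h1 ((productChart ψ).open_source.mem_nhds hxp)] with y hy hy'
    have h2 := (φ.extend (𝓡 n)).map_target hy
    rw [φ.extend_source] at h2
    have h3 := hx.meanCurvature_eq_zero φ hφ _ hψ' _ h2 hy'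
    rwa [(φ.extend (𝓡 n)).right_inv hy] at h3
  have hlocal : IsLocalMax (fun y => σ * (X y).1) y₀ := by
    have h1 := hcont.tendsto
    rw [hsymm₀] at h1
    filter_upwards [h1.eventually hmax] with y hy
    simpa only [hXfst, hsymm₀] using hy
  have hconst := eventually_fst_eq_of_isLocalMax hσ
    ((contDiffAt_chart_representation hφ hψ' hx.contMDiff hy₀t hxp).of_le ENat.LEInfty.out)
    ((contDiffAt_splitChartMetric hI hβ hg hψ hX₀I hX₀t).of_le (by simp))
    ((hβ.contDiffAt (hI.mem_nhds hX₀I)).of_le (by simp)) (hβ0 _ hX₀I)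
    (fun w hw => splitChartMetric_pos hβ0 hg hψ hX₀I hX₀t hw)
    (injective_fderiv_chart_representation hφ hψ' hx.contMDiff hx.injective_mfderiv hy₀t hxp)
    (hev.mono fun q hq => isSplitAt_splitChartMetric hψ hq.2)
    (hev.mono fun q hq => splitChartMetric_symm hg hψ hq.1 hq.2)
    (hev.mono fun q hq w => by
      rw [fderiv_splitChartMetric_vertical hI hβ hg hψ hq.1 hq.2]
      exact hmono _ hq.1 _ _) hH hlocal
  filter_upwards [(φ.continuousAt_extend (I := 𝓡 n) hpφ).eventually hconst,
    φ.open_source.mem_nhds hpφ] with p' hp' hp's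
  have h1 : (φ.extend (𝓡 n)).symm (φ.extend (𝓡 n) p') = p' :=
    (φ.extend (𝓡 n)).left_inv (by rwa [φ.extend_source])
  rwa [hXfst, hXfst, h1, hsymm₀] at hp'

/-- A compact connected minimal submanifold of a monotone split metric lies in a slice. -/
theorem IsMinimalSubmanifold.fst_eq [IsManifold (𝓡 n) ∞ S] [CompactSpace S] [ConnectedSpace S] (hI : IsOpen I)
    (hβ : ContDiffOn ℝ ∞ β I) (hβ0 : ∀ t ∈ I, 0 < β t) (hg : IsRiemannianMetricFamily I g)
    (hmono : IsMonotone I β g)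
    (hx : IsMinimalSubmanifold (𝓡 n) (𝓘(ℝ, ℝ).prod (𝓡 k)) (splitMetric β g) x)
    (hxI : ∀ p, (x p).1 ∈ I) : ∃ p₀, ∀ p, (x p).1 = (x p₀).1 := by
  obtain ⟨σ, hσ, hmono'⟩ : ∃ σ : ℝ, σ ≠ 0 ∧ ∀ t ∈ I, ∀ (p : F) (v : TangentSpace (𝓡 k) p),
      0 ≤ σ * deriv (fun s => g s p v v) t := by
    rcases hmono with h | h
    · exact ⟨1, one_ne_zero, fun t ht p v => by simpa using (h t ht).2 p v⟩
    · exact ⟨-1, by simp, fun t ht p v => by simpa using (h t ht).2 p v⟩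
  have hcont : Continuous fun p => (x p).1 := continuous_fst.comp hx.contMDiff.continuous
  obtain ⟨p₀, -, hp₀⟩ := isCompact_univ.exists_isMaxOn Set.univ_nonempty
    (continuous_const.mul hcont).continuousOn (f := fun p => σ * (x p).1)
  refine ⟨p₀, fun p => ?_⟩
  -- Every point of this set is a global maximum of `σ t`, so the local statement gives openness.
  have hclopen : IsClopen {p | (x p).1 = (x p₀).1} := by
    refine ⟨isClosed_eq hcont continuous_const, isOpen_iff_mem_nhds.2 fun p hp => ?_⟩
    have hp : (x p).1 = (x p₀).1 := hp
    have hmax : IsLocalMax (fun p => σ * (x p).1) p := Eventually.of_forall fun p' => by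
      simpa only [hp, Set.mem_ofPred_eq] using hp₀ (Set.mem_univ p')
    filter_upwards [hx.eventually_fst_eq hI hβ hβ0 hg hσ hmono' (hxI p) hmax] with p' hp'
    exact hp'.trans hp
  exact (hclopen.eq_univ ⟨p₀, rfl⟩).ge (Set.mem_univ p)

/-- A minimal submanifold of a split metric that lies in a slice is minimal in the slice. -/
theorem IsMinimalSubmanifold.snd_of_fst_eq (hI : IsOpen I)
    (hβ : ContDiffOn ℝ ∞ β I) (hβ0 : ∀ t ∈ I, 0 < β t) (hg : IsRiemannianMetricFamily I g)
    (hx : IsMinimalSubmanifold (𝓡 n) (𝓘(ℝ, ℝ).prod (𝓡 k)) (splitMetric β g) x) {t : ℝ}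
    (ht : t ∈ I) (hxt : ∀ p, (x p).1 = t) :
    IsMinimalSubmanifold (𝓡 n) (𝓡 k) (g t) fun p => (x p).2 where
  contMDiff := hx.contMDiff.snd
  injective_mfderiv p := by
    have h1 : MDifferentiableAt (𝓡 n) (𝓡 k) (fun p => (x p).2) p :=
      hx.contMDiff.snd.mdifferentiableAt (by simp)
    -- The `t`-component of `x` is constant, so the differential of `x` is carried entirely by its
    -- `F`-component and injectivity passes to it.
    have h2 : HasMFDerivAt (𝓡 n) (𝓘(ℝ, ℝ).prod (𝓡 k)) x p
        (ContinuousLinearMap.prod (0 : EuclideanSpace ℝ (Fin n) →L[ℝ] ℝ)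
          (mfderiv (𝓡 n) (𝓡 k) (fun p => (x p).2) p :
            EuclideanSpace ℝ (Fin n) →L[ℝ] EuclideanSpace ℝ (Fin k))) :=
      ((hasMFDerivAt_const t p).prodMk h1.hasMFDerivAt).congr_of_eventuallyEq
        (Eventually.of_forall fun p => Prod.ext (hxt p) rfl)
    intro a b hab
    refine hx.injective_mfderiv p ?_
    rw [h2.mfderiv]
    exact Prod.ext rfl hab
  meanCurvature_eq_zero φ hφ ψ hψ p hpφ hpψ := by
    have hψ' := productChart_mem_maximalAtlas hψ
    have hpφ' : p ∈ (φ.extend (𝓡 n)).source := by rwa [φ.extend_source]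
    have hy := (φ.extend (𝓡 n)).map_source hpφ'
    have hinv : (φ.extend (𝓡 n)).symm (φ.extend (𝓡 n) p) = p := (φ.extend (𝓡 n)).left_inv hpφ'
    have hH := hx.meanCurvature_eq_zero φ hφ _ hψ' p hpφ ⟨Set.mem_univ _, hpψ⟩
    set Y := ψ.extend (𝓡 k) ∘ (fun p => (x p).2) ∘ (φ.extend (𝓡 n)).symm with hYdef
    set y := φ.extend (𝓡 n) p
    -- In a product chart `x` is literally `(t, Y)`, the form required by the slice lemma.
    have hX : (productChart ψ).extend (𝓘(ℝ, ℝ).prod (𝓡 k)) ∘ x ∘ (φ.extend (𝓡 n)).symm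
        = fun z => (t, Y z) := funext fun z => Prod.ext (hxt _) rfl
    rw [hX] at hH
    have hYt : Y y ∈ (ψ.extend (𝓡 k)).target := by
      refine (ψ.extend (𝓡 k)).map_source ?_
      rwa [ψ.extend_source, Function.comp_apply, hinv]
    have hY : ContDiffAt ℝ ∞ Y y :=
      contDiffAt_chart_representation hφ hψ hx.contMDiff.snd hy (by rwa [hinv])
    refine localMeanCurvatureZero_of_slice (t := t) (β := β) (G := splitChartMetric β g ψ)
      (hY.of_le ENat.LEInfty.out)
      ((contDiffAt_splitChartMetric hI hβ hg hψ ht hYt).differentiableAt (by simp))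
      ((contDiffAt_chartMetric hI hg hψ ht hYt).differentiableAt (by simp))
      (isSplitAt_splitChartMetric hψ hYt)
      (fun v hv => splitChartMetric_pos hβ0 hg hψ ht hYt hv) ?_ hH
    filter_upwards [ψ.isOpen_extend_target.mem_nhds hYt] with z hz v w
    exact splitChartMetric_horizontal hψ hz v w

end Minimal

end MinimalSubmanifolds

end

theorem mainTheorem1 {n k : ℕ}
    {F : Type*} [TopologicalSpace F] [T2Space F]
    [ChartedSpace (EuclideanSpace ℝ (Fin k)) F] [IsManifold (𝓡 k) ∞ F]
    {S : Type*} [TopologicalSpace S] [T2Space S] [CompactSpace S] [ConnectedSpace S]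
    [ChartedSpace (EuclideanSpace ℝ (Fin n)) S] [IsManifold (𝓡 n) ∞ S]
    (I : Set ℝ) (hI_open : IsOpen I) (hI_interval : I.OrdConnected)
    (β : ℝ → ℝ) (hβ_smooth : ContDiffOn ℝ ∞ β I) (hβ_pos : ∀ t ∈ I, 0 < β t)
    (g : ℝ → (p : F) → TangentSpace (𝓡 k) p →L[ℝ] TangentSpace (𝓡 k) p →L[ℝ] ℝ)
    (hg : MinimalSubmanifolds.IsRiemannianMetricFamily I g)
    (hmono : MinimalSubmanifolds.IsMonotone I β g)
    (x : S → ℝ × F) (hxI : ∀ p, (x p).1 ∈ I)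
    (hx : MinimalSubmanifolds.IsMinimalSubmanifold (𝓡 n) (𝓘(ℝ, ℝ).prod (𝓡 k))
      (MinimalSubmanifolds.splitMetric β g) x) :
    ∃ t₀ ∈ I, (∀ p, (x p).1 = t₀) ∧
      -- the codimension of `S` in `I × F` is `k + 1 - n`
      (n + 1 < k + 1 → MinimalSubmanifolds.IsMinimalSubmanifold (𝓡 n) (𝓡 k) (g t₀)
        (fun p => (x p).2)) := by
  obtain ⟨p₀, hp₀⟩ := hx.fst_eq hI_open hβ_smooth hβ_pos hg hmono hxI
  exact ⟨(x p₀).1, hxI p₀, hp₀, fun _ =>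
    hx.snd_of_fst_eq hI_open hβ_smooth hβ_pos hg (hxI p₀) hp₀⟩
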